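/- Let $p$ be a prime and let $G$ be a finite $p$-group which is a Camina group, i.e. every conjugacy class of $G$ outside the derived subgroup $G'$ is a coset of $G'$. For each conjugacy class $C$ of $G$ let $A_C$ be the $G\times G$ complex matrix with $(A_C)_{xy}=1$ if $yx^{-1}\in C$ and $0$ otherwise; these are the adjacency matrices of the group association scheme of $G$. Let $\mathfrak A$ be the $\mathbb C$-span of the matrices $A_C$, let $E_C^*$ be the diagonal matrix with $(E_C^*)_{yy}=(A_C)_{ey}$, where $e$ is the identity of $G$, and let $\mathfrak A^*$ be the $\mathbb C$-span of the matrices $E_C^*$. Let $T(G)$, the Terwilliger algebra of $G$, be the subalgebra of $M_{|G|}(\mathbb C)$ generated by $\mathfrak A$ and $\mathfrak A^*$. Let $\hat e\in\mathbb C^{G}$ be the coordinate vector at $e$; the $T(G)$-submodule $\mathfrak A\hat e$ of $\mathbb C^{G}$ is called the primary module. Then $T(G)$ is almost commutative: every irreducible $T(G)$-module that is not isomorphic to the primary module has dimension $1$ over $\mathbb C$. -/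

import Mathlib

universe u w

open scoped Pointwise

/-- A (finite) association scheme on `Ω`, given by its adjacency matrices `A i`, `i : ι`.
The index `zero` plays the role of `0` in `A 0, …, A d`. -/
structure AssociationScheme (Ω : Type*) [Fintype Ω] [DecidableEq Ω] (ι : Type*) [Fintype ι] where
  /-- the adjacency matrices -/
  A : ι → Matrix Ω Ω ℂ
  /-- the index of the identity relation -/
  zero : ι
  zero_or_one : ∀ i x y, A i x y = 0 ∨ A i x y = 1
  A_zero : A zero = 1
  exists_transpose : ∀ i, ∃ j, (A i).transpose = A j
  exists_intersection : ∀ i j, ∃ p : ι → ℂ, A i * A j = ∑ k, p k • A k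
  ne_zero : ∀ i, A i ≠ 0
  sum_eq : ∑ i, A i = Matrix.of fun _ _ => 1

namespace AssociationScheme

section

variable {Ω : Type*} [Fintype Ω] [DecidableEq Ω] {ι : Type*} [Fintype ι]

/-- The Bose–Mesner algebra, as a space of matrices. -/
def boseMesner (S : AssociationScheme Ω ι) : Submodule ℂ (Matrix Ω Ω ℂ) :=
  Submodule.span ℂ (Set.range S.A)

/-- The dual idempotent `E_i^*(x)`: the diagonal matrix carrying row `x` of `A i`. -/
def dualIdempotent (S : AssociationScheme Ω ι) (x : Ω) (i : ι) : Matrix Ω Ω ℂ :=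
  Matrix.diagonal (S.A i x)

/-- The dual Bose–Mesner algebra with base point `x`, as a space of matrices. -/
def dualBoseMesner (S : AssociationScheme Ω ι) (x : Ω) : Submodule ℂ (Matrix Ω Ω ℂ) :=
  Submodule.span ℂ (Set.range (S.dualIdempotent x))

/-- The Terwilliger algebra `T(x)`: the subalgebra of the full matrix algebra generated by the
Bose–Mesner algebra and the dual Bose–Mesner algebra. -/
def terwilligerAlgebra (S : AssociationScheme Ω ι) (x : Ω) : Subalgebra ℂ (Matrix Ω Ω ℂ) :=
  Algebra.adjoin ℂ ((S.boseMesner : Set (Matrix Ω Ω ℂ)) ∪ (S.dualBoseMesner x))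

/-- The subspace `𝔄 x̂` of `ℂ^Ω`, where `x̂` is the coordinate vector at `x`. -/
def primarySubspace (S : AssociationScheme Ω ι) (x : Ω) : Submodule ℂ (Ω → ℂ) :=
  S.boseMesner.map ((Matrix.mulVecBilin ℂ ℂ).flip (Pi.single x 1))

theorem mem_primarySubspace (S : AssociationScheme Ω ι) (x : Ω) (v : Ω → ℂ) :
    v ∈ S.primarySubspace x ↔ ∃ B ∈ S.boseMesner, B.mulVec (Pi.single x 1) = v := by
  simp [primarySubspace, Submodule.mem_map]

theorem mul_eq_zero_of_ne (S : AssociationScheme Ω ι) {i j : ι} (h : i ≠ j) (x y : Ω) :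
    S.A i x y * S.A j x y = 0 := by
  classical
  rcases S.zero_or_one i x y with hi | hi
  · simp [hi]
  rcases S.zero_or_one j x y with hj | hj
  · simp [hj]
  exfalso
  have h1 : ∑ k, S.A k x y = 1 := by
    have := congrFun (congrFun S.sum_eq x) y
    simpa [Matrix.sum_apply] using this
  have h2 : ∑ k, (S.A k x y).re = 1 := by
    rw [← Complex.re_sum, h1, Complex.one_re]
  have h3 : ∑ k ∈ ({i, j} : Finset ι), (S.A k x y).re ≤ ∑ k, (S.A k x y).re := by
    refine Finset.sum_le_sum_of_subset_of_nonneg (Finset.subset_univ _) fun k _ _ => ?_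
    rcases S.zero_or_one k x y with hk | hk <;> simp [hk]
  rw [Finset.sum_pair h, h2, hi, hj] at h3
  norm_num at h3

theorem mul_mem_boseMesner (S : AssociationScheme Ω ι) {B C : Matrix Ω Ω ℂ}
    (hB : B ∈ S.boseMesner) (hC : C ∈ S.boseMesner) : B * C ∈ S.boseMesner := by
  unfold boseMesner at hB hC
  induction hB using Submodule.span_induction with
  | mem B hB =>
    obtain ⟨i, rfl⟩ := hB
    induction hC using Submodule.span_induction with
    | mem C hC =>
      obtain ⟨j, rfl⟩ := hC
      obtain ⟨p, hp⟩ := S.exists_intersection i j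
      rw [hp]
      exact Submodule.sum_mem _ fun k _ =>
        Submodule.smul_mem _ _ (Submodule.subset_span ⟨k, rfl⟩)
    | zero => simp
    | add C D _ _ h1 h2 => rw [mul_add]; exact Submodule.add_mem _ h1 h2
    | smul a C _ h1 => rw [mul_smul_comm]; exact Submodule.smul_mem _ _ h1
  | zero => simp
  | add B D _ _ h1 h2 => rw [add_mul]; exact Submodule.add_mem _ h1 h2
  | smul a B _ h1 => rw [smul_mul_assoc]; exact Submodule.smul_mem _ _ h1

theorem dual_mulVec_mem (S : AssociationScheme Ω ι) (x : Ω) {t : Matrix Ω Ω ℂ}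
    (ht : t ∈ S.dualBoseMesner x) {B : Matrix Ω Ω ℂ} (hB : B ∈ S.boseMesner) :
    t.mulVec (B.mulVec (Pi.single x 1)) ∈ S.primarySubspace x := by
  unfold dualBoseMesner at ht
  unfold boseMesner at hB
  induction ht using Submodule.span_induction with
  | mem t ht =>
    obtain ⟨i, rfl⟩ := ht
    induction hB using Submodule.span_induction with
    | mem B hB =>
      obtain ⟨j, rfl⟩ := hB
      obtain ⟨k, hk⟩ := S.exists_transpose j
      have hjk : ∀ y, S.A j y x = S.A k x y := fun y => by rw [← hk]; rfl
      by_cases hik : i = k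
      · refine (S.mem_primarySubspace x _).2 ⟨S.A j, Submodule.subset_span ⟨j, rfl⟩, ?_⟩
        ext y
        simp only [dualIdempotent, Matrix.mulVec_diagonal, Matrix.mulVec_single_one, Matrix.col_apply, hjk,
          hik]
        rcases S.zero_or_one k x y with h | h <;> simp [h]
      · have h0 : (S.dualIdempotent x i).mulVec ((S.A j).mulVec (Pi.single x 1)) = 0 := by
          ext y
          simp only [dualIdempotent, Matrix.mulVec_diagonal, Matrix.mulVec_single_one, Matrix.col_apply,
            hjk, S.mul_eq_zero_of_ne hik, Pi.zero_apply]
        rw [h0]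
        exact Submodule.zero_mem _
    | zero =>
      rw [Matrix.zero_mulVec, Matrix.mulVec_zero]
      exact Submodule.zero_mem _
    | add C D _ _ h1 h2 =>
      rw [Matrix.add_mulVec, Matrix.mulVec_add]; exact Submodule.add_mem _ h1 h2
    | smul a C _ h1 =>
      rw [Matrix.smul_mulVec, Matrix.mulVec_smul]; exact Submodule.smul_mem _ _ h1
  | zero => simp
  | add C D _ _ h1 h2 => rw [Matrix.add_mulVec]; exact Submodule.add_mem _ h1 h2
  | smul a C _ h1 => rw [Matrix.smul_mulVec]; exact Submodule.smul_mem _ _ h1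

theorem terwilliger_mulVec_mem (S : AssociationScheme Ω ι) (x : Ω) {t : Matrix Ω Ω ℂ}
    (ht : t ∈ S.terwilligerAlgebra x) {v : Ω → ℂ} (hv : v ∈ S.primarySubspace x) :
    t.mulVec v ∈ S.primarySubspace x := by
  unfold terwilligerAlgebra at ht
  induction ht using Algebra.adjoin_induction generalizing v with
  | mem t ht =>
    obtain ⟨B, hB, rfl⟩ := (S.mem_primarySubspace x v).1 hv
    rcases ht with ht | ht
    · rw [Matrix.mulVec_mulVec]
      exact (S.mem_primarySubspace x _).2 ⟨t * B, S.mul_mem_boseMesner ht hB, rfl⟩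
    · exact S.dual_mulVec_mem x ht hB
  | algebraMap r =>
    rw [Algebra.algebraMap_eq_smul_one, Matrix.smul_mulVec, Matrix.one_mulVec]
    exact Submodule.smul_mem _ _ hv
  | add s t _ _ h1 h2 => rw [Matrix.add_mulVec]; exact Submodule.add_mem _ (h1 hv) (h2 hv)
  | mul s t _ _ h1 h2 => rw [← Matrix.mulVec_mulVec]; exact h1 (h2 hv)

/-- The primary module `𝔄 x̂`, as a `T(x)`-submodule of `ℂ^Ω` (with matrices acting by left
multiplication on column vectors). -/
def primaryModule (S : AssociationScheme Ω ι) (x : Ω) :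
    Submodule (S.terwilligerAlgebra x) (Ω → ℂ) where
  carrier := S.primarySubspace x
  add_mem' := (S.primarySubspace x).add_mem
  zero_mem' := (S.primarySubspace x).zero_mem
  smul_mem' t _ hv := S.terwilliger_mulVec_mem x t.2 hv

/-- The Terwilliger algebra `T(x)` is almost commutative if every irreducible `T(x)`-module that is
not isomorphic to the primary module is one-dimensional over `ℂ`. -/
def IsAlmostCommutative.{v} (S : AssociationScheme Ω ι) (x : Ω) : Prop :=
  ∀ (M : Type v) [AddCommGroup M] [Module ℂ M] [Module (S.terwilligerAlgebra x) M]
    [IsScalarTower ℂ (S.terwilligerAlgebra x) M],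
    IsSimpleModule (S.terwilligerAlgebra x) M →
    ¬ Nonempty (M ≃ₗ[S.terwilligerAlgebra x] S.primaryModule x) →
    Module.finrank ℂ M = 1

end

end AssociationScheme

section

variable (G : Type*) [Group G] [Fintype G] [DecidableEq G]

/-- The adjacency matrix of a conjugacy class `C`: its `(x, y)` entry is `1` if `y x⁻¹ ∈ C` and `0`
otherwise. -/
def groupAdjacency (C : ConjClasses G) : Matrix G G ℂ :=
  Matrix.of fun x y => if ConjClasses.mk (y * x⁻¹) = C then 1 else 0

/-- The group association scheme of a finite group. -/
def groupAssociationScheme : AssociationScheme G (ConjClasses G) where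
  A := groupAdjacency G
  zero := ConjClasses.mk 1
  zero_or_one C x y := by
    by_cases h : ConjClasses.mk (y * x⁻¹) = C <;> simp [groupAdjacency, h]
  A_zero := by
    ext x y
    simp only [groupAdjacency, Matrix.of_apply, Matrix.one_apply]
    have : ConjClasses.mk (y * x⁻¹) = ConjClasses.mk 1 ↔ x = y := by
      rw [ConjClasses.mk_eq_mk_iff_isConj, isConj_comm, isConj_one_right, mul_inv_eq_one, eq_comm]
    simp [this]
  exists_transpose C := by
    obtain ⟨g, rfl⟩ := ConjClasses.exists_rep C
    refine ⟨ConjClasses.mk g⁻¹, ?_⟩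
    ext x y
    have key : ∀ a b : G, IsConj a b → IsConj a⁻¹ b⁻¹ := fun a b h => by
      obtain ⟨c, hc⟩ := isConj_iff.1 h
      exact isConj_iff.2 ⟨c, by rw [← hc]; group⟩
    have : ConjClasses.mk (x * y⁻¹) = ConjClasses.mk g ↔
        ConjClasses.mk (y * x⁻¹) = ConjClasses.mk g⁻¹ := by
      simp only [ConjClasses.mk_eq_mk_iff_isConj]
      constructor <;> intro h
      · simpa using key _ _ h
      · simpa using key _ _ h
    simp [groupAdjacency, this]
  exists_intersection C D := by
    let n : G → ℂ := fun w => ∑ t : G,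
      (if ConjClasses.mk t = C then 1 else 0) * (if ConjClasses.mk (w * t⁻¹) = D then 1 else 0)
    have hn : ∀ w w' : G, ConjClasses.mk w = ConjClasses.mk w' → n w = n w' := by
      intro w w' h
      obtain ⟨c, rfl⟩ := isConj_iff.1 (ConjClasses.mk_eq_mk_iff_isConj.1 h)
      refine Fintype.sum_equiv (MulAut.conj c).toEquiv _ _ fun t => ?_
      have h1 : ConjClasses.mk (c * t * c⁻¹) = ConjClasses.mk t :=
        ConjClasses.mk_eq_mk_iff_isConj.2 (isConj_comm.1 (isConj_iff.2 ⟨c, rfl⟩))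
      have h2 : ConjClasses.mk (c * w * c⁻¹ * (c * t * c⁻¹)⁻¹) = ConjClasses.mk (w * t⁻¹) :=
        ConjClasses.mk_eq_mk_iff_isConj.2 (isConj_comm.1 (isConj_iff.2 ⟨c, by group⟩))
      simp only [MulEquiv.toEquiv_eq_coe, MulEquiv.coe_toEquiv, MulAut.conj_apply, h1, h2]
    refine ⟨fun K => n (Quotient.out K), ?_⟩
    ext x y
    have h1 : (groupAdjacency G C * groupAdjacency G D) x y = n (y * x⁻¹) := by
      rw [Matrix.mul_apply]
      refine Fintype.sum_equiv (Equiv.mulRight x⁻¹) _ _ fun z => ?_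
      have h2 : y * x⁻¹ * (z * x⁻¹)⁻¹ = y * z⁻¹ := by group
      simp only [groupAdjacency, Matrix.of_apply, Equiv.coe_mulRight, h2]
      congr
    rw [h1, Matrix.sum_apply, Finset.sum_eq_single (ConjClasses.mk (y * x⁻¹))]
    · simp only [Matrix.smul_apply, groupAdjacency, Matrix.of_apply, if_true, smul_eq_mul, mul_one]
      exact hn _ _ (Quotient.out_eq (ConjClasses.mk (y * x⁻¹))).symm
    · intro K _ hK
      simp [groupAdjacency, hK.symm]
    · simp
  ne_zero C h := by
    obtain ⟨g, rfl⟩ := ConjClasses.exists_rep C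
    have := congrFun (congrFun h 1) g
    simp [groupAdjacency] at this
  sum_eq := by
    ext x y
    simp [groupAdjacency, Matrix.sum_apply]

/-- A Camina group: every conjugacy class of `G` outside the derived subgroup `G'` is a coset of
`G'`. -/
def IsCaminaGroup (G : Type*) [Group G] : Prop :=
  ∀ C : ConjClasses G, Disjoint C.carrier (commutator G : Set G) →
    ∃ g : G, C.carrier = g • (commutator G : Set G)

end

/-!
The proof has two independent halves.

*Classes to modules.* Suppose that for nonconjugate `x`, `y` the class of `y x⁻¹` depends only on
the classes of `x` and `y`. Then every off-diagonal block `E_C^* A_K E_D^*`, `C ≠ D`, is a multiple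
of `E_C^* J E_D^*`, where `J` is the all-ones matrix. If some `E_C^* J E_D^*` acts nontrivially on a
simple module `M`, then `M` is generated by a vector with the same annihilator as `ê`, so it is the
primary module (`nonempty_equiv_primaryModule`). Otherwise the off-diagonal blocks act as zero, the
generators of the Terwilliger algebra act on `M` by commuting operators
(`smul_comm_of_primaryUnit_smul_eq_zero`), and `dim M = 1` by Schur's lemma.

*Classes of a Camina `p`-group.* Write `γ₁ = G, γ₂ = G', …` for the lower central series, so that
`γᵢ` is `lcs G (i - 1)`. It is enough to show that the class of an element of `γᵢ` outside `γᵢ₊₁` is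
a coset of `γᵢ₊₁` (`isConj_mul`, `isConj_mul_inv`). For `i = 1` this is the Camina condition; for
`i = 2` and for `γ₄ = 1` it is a theorem of Macdonald; and `γ₄ = 1` is the theorem of Dark and
Scoppola that Camina `p`-groups have class at most three. Both theorems become linear algebra over
`F = ZMod p`. The commutator bracket `b : V × V → W` of the sections `V = γ₁/γ₂` and `W = γ₂/γ₃` is
alternating, and `b(x, ·)` is onto for `x ≠ 0`.

The basic tool, `two_mul_finrank_le_of_nondegenerate`, says that a linear space of alternating forms
on `V` whose nonzero members are nondegenerate has dimension at most `dim V / 2`: the Pfaffian of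
the family has only the trivial zero, so the Chevalley–Warning theorem applies. With `m = dim W` it
gives `2m ≤ dim V`. If `μ` is a nonzero functional on `γ₃/γ₄`, the pairing `ψ(w, x) = μ[w, x]` and the
Jacobi identity force equality, `ψ` is nondegenerate in `W`, and the kernel of `ψ` in `V` is totally
isotropic of dimension `m` (`finrank_of_class_three`). Nondegeneracy in `W` is the case `i = 2`.

Suppose now that `γ₄ ≠ 1 = γ₅`, let `τ` be a nonzero functional on `γ₄`, and put
`Φ(w, x, c) = τ[[w, x], c]` and `β(w, w') = τ[w, w']`. Let `V₁` be the radical of `Φ` in the last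
variable, and for `x ≠ 0` let `D(x)` be the space of all `c` with `Φ(·, x, c) = 0`.

* The forms `(h, k) ↦ τ[[h, k], c]`, for `c` in a complement of `V₁` in `D(x)`, are nondegenerate on
  the kernel of `b(x, ·)` by the Camina condition, so that `dim D(x) - dim V₁ ≤ m / 2`.
* Counting the pairs `(x, c)` with `c ∈ D(x)` outside `V₁` then gives `dim V₁ > m / 2`.
* For `x ∈ V₁` nonzero, `D(x)` is the preimage under `b(x, ·)` of the radical `R` of `β`. If `p` is
  odd, the forms `β(b(x, v), b(y, v'))`, for `y ∈ V₁` commuting with `x`, are alternating and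
  nondegenerate on `V / D(x)`. This bounds their number, and with the first inequality it gives
  `dim V₁ ≤ m / 2`, a contradiction (`false_of_class_four`).

For `p = 2` already class three is impossible: the squaring map of `γ₂` determines `ψ(w, y)`
independently of `y` outside the kernel of `ψ` (`lcs_two_eq_bot_of_two`).
-/

/-! ### A criterion for almost commutativity -/

namespace AssociationScheme

variable {Ω : Type*} [Fintype Ω] [DecidableEq Ω] {ι : Type*} [Fintype ι]

theorem exists_A_eq_one (S : AssociationScheme Ω ι) (x y : Ω) : ∃ i, S.A i x y = 1 := by
  by_contra! h
  have h0 : ∀ i, S.A i x y = 0 := fun i => (S.zero_or_one i x y).resolve_right (h i)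
  have h1 := congrFun (congrFun S.sum_eq x) y
  simp [Matrix.sum_apply, h0] at h1

theorem A_zero_row (S : AssociationScheme Ω ι) (x : Ω) : S.A S.zero x = Pi.single x 1 := by
  rw [S.A_zero]
  ext y
  simp [Matrix.one_apply, Pi.single_apply, eq_comm]

/-- The matrix `E_i^* J E_j^*`, with `J` the all-ones matrix. -/
def primaryUnit (S : AssociationScheme Ω ι) (x : Ω) (i j : ι) : Matrix Ω Ω ℂ :=
  Matrix.vecMulVec (S.A i x) (S.A j x)

theorem sum_dualIdempotent (S : AssociationScheme Ω ι) (x : Ω) :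
    ∑ i, S.dualIdempotent x i = 1 := by
  ext a b
  have h := congrFun (congrFun S.sum_eq x) a
  rw [Matrix.sum_apply] at h ⊢
  by_cases hab : a = b
  · subst hab
    simpa [dualIdempotent] using h
  · simp [dualIdempotent, hab]

theorem terwilligerAlgebra_eq_adjoin (S : AssociationScheme Ω ι) (x : Ω) :
    S.terwilligerAlgebra x =
      Algebra.adjoin ℂ (Set.range S.A ∪ Set.range (S.dualIdempotent x)) := by
  rw [terwilligerAlgebra, boseMesner, dualBoseMesner, Algebra.adjoin_union, Algebra.adjoin_span,
    Algebra.adjoin_span, ← Algebra.adjoin_union]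

theorem A_mem (S : AssociationScheme Ω ι) (x : Ω) (i : ι) : S.A i ∈ S.terwilligerAlgebra x := by
  rw [terwilligerAlgebra_eq_adjoin]
  exact Algebra.subset_adjoin (Or.inl ⟨i, rfl⟩)

theorem dualIdempotent_mem (S : AssociationScheme Ω ι) (x : Ω) (i : ι) :
    S.dualIdempotent x i ∈ S.terwilligerAlgebra x := by
  rw [terwilligerAlgebra_eq_adjoin]
  exact Algebra.subset_adjoin (Or.inr ⟨i, rfl⟩)

theorem primaryUnit_mem (S : AssociationScheme Ω ι) (x : Ω) (i j : ι) :
    S.primaryUnit x i j ∈ S.terwilligerAlgebra x := by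
  have h : S.primaryUnit x i j =
      S.dualIdempotent x i * (∑ k, S.A k) * S.dualIdempotent x j := by
    ext a b
    simp [primaryUnit, dualIdempotent, S.sum_eq, Matrix.vecMulVec_apply]
  rw [h]
  exact mul_mem (mul_mem (S.dualIdempotent_mem x i) (sum_mem fun k _ => S.A_mem x k))
    (S.dualIdempotent_mem x j)

theorem mul_primaryUnit_zero (S : AssociationScheme Ω ι) (x : Ω) (t : Matrix Ω Ω ℂ) (j : ι) :
    t * S.primaryUnit x S.zero j = Matrix.vecMulVec (t.mulVec (Pi.single x 1)) (S.A j x) := by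
  rw [primaryUnit, Matrix.mul_vecMulVec, A_zero_row]

theorem primaryUnit_mul_primaryUnit (S : AssociationScheme Ω ι) (x : Ω) (i j : ι) :
    S.primaryUnit x i S.zero * S.primaryUnit x S.zero j = S.primaryUnit x i j := by
  rw [mul_primaryUnit_zero, primaryUnit, primaryUnit]
  congr 1
  ext a
  simp [Matrix.vecMulVec_apply, A_zero_row]

/-- A vector of the primary module is constant on each subconstituent. -/
theorem eq_of_mem_primarySubspace (S : AssociationScheme Ω ι) (x : Ω) {v : Ω → ℂ}
    (hv : v ∈ S.primarySubspace x) {i : ι} {a b : Ω} (ha : S.A i x a = 1) (hb : S.A i x b = 1) :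
    v a = v b := by
  obtain ⟨B, hB, rfl⟩ := (S.mem_primarySubspace x v).1 hv
  simp only [Matrix.mulVec_single_one, Matrix.col_apply]
  clear hv
  unfold boseMesner at hB
  induction hB using Submodule.span_induction with
  | mem B hB =>
    obtain ⟨j, rfl⟩ := hB
    obtain ⟨k, hk⟩ := S.exists_transpose j
    have hjk : ∀ y, S.A j y x = S.A k x y := fun y => by rw [← hk]; rfl
    rw [hjk, hjk]
    by_cases h : i = k
    · subst h
      rw [ha, hb]
    · have h1 := S.mul_eq_zero_of_ne h x a
      have h2 := S.mul_eq_zero_of_ne h x b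
      rw [ha, one_mul] at h1
      rw [hb, one_mul] at h2
      rw [h1, h2]
  | zero => rfl
  | add C D _ _ h1 h2 => simp only [Matrix.add_apply, h1, h2]
  | smul c C _ h1 => simp only [Matrix.smul_apply, h1]

theorem dotProduct_ne_zero_of_mem_primarySubspace (S : AssociationScheme Ω ι) (x : Ω) {v : Ω → ℂ}
    (hv : v ∈ S.primarySubspace x) {i : ι} {a : Ω} (ha : S.A i x a = 1) (hva : v a ≠ 0) :
    S.A i x ⬝ᵥ v ≠ 0 := by
  have h1 : S.A i x ⬝ᵥ v = (∑ b, S.A i x b) * v a := by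
    rw [dotProduct, Finset.sum_mul]
    refine Finset.sum_congr rfl fun b _ => ?_
    rcases S.zero_or_one i x b with h | h
    · simp [h]
    · rw [S.eq_of_mem_primarySubspace x hv ha h]
  rw [h1]
  refine mul_ne_zero (fun h0 => ?_) hva
  have h2 : ∑ b, (S.A i x b).re = 0 := by rw [← Complex.re_sum, h0, Complex.zero_re]
  have h3 := (Finset.sum_eq_zero_iff_of_nonneg fun b _ => by
    rcases S.zero_or_one i x b with h | h <;> simp [h]).1 h2 a (Finset.mem_univ a)
  simp [ha] at h3

/-- Two cyclic modules whose generators have the same annihilator are isomorphic. -/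
theorem nonempty_linearEquiv_of_smul_eq_zero_iff {R M N : Type*} [Ring R] [AddCommGroup M]
    [Module R M] [AddCommGroup N] [Module R N] {m : M} {n : N}
    (hm : Function.Surjective fun t : R => t • m) (hn : Function.Surjective fun t : R => t • n)
    (h : ∀ t : R, t • m = 0 ↔ t • n = 0) : Nonempty (M ≃ₗ[R] N) := by
  have hker : LinearMap.ker (LinearMap.toSpanSingleton R M m) =
      LinearMap.ker (LinearMap.toSpanSingleton R N n) := by
    ext t
    simpa using h t
  exact ⟨((LinearMap.toSpanSingleton R M m).quotKerEquivOfSurjective hm).symm.trans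
    ((Submodule.quotEquivOfEq _ _ hker).trans
      ((LinearMap.toSpanSingleton R N n).quotKerEquivOfSurjective hn))⟩

section Module

variable (S : AssociationScheme Ω ι) (x : Ω) {M : Type*} [AddCommGroup M]
  [Module (S.terwilligerAlgebra x) M]

/-- A simple module on which some `E_i^* J E_j^*` acts as a nonzero map is the primary module:
both are cyclic, and the generators `(E_0^* J E_j^*) m` and `x̂` have the same annihilator. -/
theorem nonempty_equiv_primaryModule (hM : IsSimpleModule (S.terwilligerAlgebra x) M) {i j : ι}
    {m : M} (hm : (⟨_, S.primaryUnit_mem x i j⟩ : S.terwilligerAlgebra x) • m ≠ 0) :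
    Nonempty (M ≃ₗ[S.terwilligerAlgebra x] S.primaryModule x) := by
  set m₁ : M := (⟨_, S.primaryUnit_mem x S.zero j⟩ : S.terwilligerAlgebra x) • m with hm₁
  have hm₁0 : m₁ ≠ 0 := by
    intro h0
    apply hm
    have : (⟨_, S.primaryUnit_mem x i j⟩ : S.terwilligerAlgebra x) =
        ⟨_, S.primaryUnit_mem x i S.zero⟩ * ⟨_, S.primaryUnit_mem x S.zero j⟩ :=
      Subtype.ext (S.primaryUnit_mul_primaryUnit x i j).symm
    rw [this, mul_smul, ← hm₁, h0, smul_zero]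
  have hmem : Pi.single x 1 ∈ S.primarySubspace x :=
    (S.mem_primarySubspace x _).2 ⟨S.A S.zero, Submodule.subset_span ⟨_, rfl⟩, by
      rw [S.A_zero, Matrix.one_mulVec]⟩
  let e : S.primaryModule x := ⟨Pi.single x 1, hmem⟩
  refine nonempty_linearEquiv_of_smul_eq_zero_iff (m := m₁) (n := e)
    (IsSimpleModule.toSpanSingleton_surjective _ hm₁0) ?_ ?_
  · rintro ⟨v, hv⟩
    obtain ⟨B, hB, rfl⟩ := (S.mem_primarySubspace x v).1 hv
    exact ⟨⟨B, Algebra.subset_adjoin (Or.inl hB)⟩, rfl⟩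
  · refine fun t => Iff.trans (b := (t : Matrix Ω Ω ℂ).mulVec (Pi.single x 1) = 0) ?_
      ⟨fun h => Subtype.ext h, fun h => congrArg Subtype.val h⟩
    constructor
    · intro ht
      by_contra h0
      have hv : (t : Matrix Ω Ω ℂ).mulVec (Pi.single x 1) ∈ S.primarySubspace x :=
        S.terwilliger_mulVec_mem x t.2 hmem
      obtain ⟨a, ha⟩ := Function.ne_iff.1 h0
      obtain ⟨k, hk⟩ := S.exists_A_eq_one x a
      have hne := S.dotProduct_ne_zero_of_mem_primarySubspace x hv hk ha
      set c : ℂ := S.A k x ⬝ᵥ (t : Matrix Ω Ω ℂ).mulVec (Pi.single x 1) with hc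
      have h2 : c⁻¹ • ((⟨_, S.primaryUnit_mem x S.zero k⟩ : S.terwilligerAlgebra x) *
          (t * ⟨_, S.primaryUnit_mem x S.zero j⟩)) = ⟨_, S.primaryUnit_mem x S.zero j⟩ := by
        refine Subtype.ext ?_
        change c⁻¹ • (S.primaryUnit x S.zero k * ((t : Matrix Ω Ω ℂ) *
          S.primaryUnit x S.zero j)) = S.primaryUnit x S.zero j
        rw [mul_primaryUnit_zero, primaryUnit, primaryUnit, Matrix.vecMulVec_mul_vecMulVec, ← hc]
        ext a b
        simp only [Matrix.vecMulVec_apply, Matrix.smul_apply, Pi.smul_apply, smul_eq_mul]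
        field_simp
      apply hm₁0
      rw [hm₁, ← h2, ← smul_mul_assoc, mul_smul, mul_smul, ← hm₁, ht, smul_zero]
    · intro h0
      have : t * ⟨_, S.primaryUnit_mem x S.zero j⟩ = 0 := by
        refine Subtype.ext ?_
        change (t : Matrix Ω Ω ℂ) * S.primaryUnit x S.zero j = 0
        rw [mul_primaryUnit_zero, h0, Matrix.zero_vecMulVec]
      rw [hm₁, ← mul_smul, this, zero_smul]

/-- If every `E_i^* J E_j^*` annihilates `M`, then the off-diagonal blocks `E_i^* A_k E_j^*` of the
adjacency matrices act as zero, so the generators of the Terwilliger algebra commute on `M`. -/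
theorem smul_comm_of_primaryUnit_smul_eq_zero
    (hcomm : ∀ i j, S.A i * S.A j = S.A j * S.A i)
    (hoff : ∀ i j k, i ≠ j → ∃ c : ℂ,
      S.dualIdempotent x i * S.A k * S.dualIdempotent x j = c • S.primaryUnit x i j)
    (hzero : ∀ i j (m : M), (⟨_, S.primaryUnit_mem x i j⟩ : S.terwilligerAlgebra x) • m = 0)
    (s t : S.terwilligerAlgebra x) (m : M) : s • t • m = t • s • m := by
  let A : ι → S.terwilligerAlgebra x := fun i => ⟨S.A i, S.A_mem x i⟩
  let E : ι → S.terwilligerAlgebra x := fun i => ⟨S.dualIdempotent x i, S.dualIdempotent_mem x i⟩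
  let ρ : S.terwilligerAlgebra x →+* AddMonoid.End M := Module.toAddMonoidEnd _ M
  have hsumE : ∑ i, E i = 1 := Subtype.ext (by
    simpa [E] using S.sum_dualIdempotent x)
  have hoff' : ∀ i j k, i ≠ j → ρ (E i * A k * E j) = 0 := by
    intro i j k hij
    obtain ⟨c, hc⟩ := hoff i j k hij
    have : E i * A k * E j = algebraMap ℂ (S.terwilligerAlgebra x) c *
        ⟨_, S.primaryUnit_mem x i j⟩ := by
      rw [← Algebra.smul_def]
      exact Subtype.ext hc
    ext m
    change (E i * A k * E j) • m = 0
    rw [this, mul_smul, hzero, smul_zero]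
  have hEA : ∀ i k, Commute (ρ (E i)) (ρ (A k)) := by
    intro i k
    have h1 : ρ (E i * A k) = ρ (E i * A k * E i) := by
      conv_lhs => rw [← mul_one (E i * A k), ← hsumE, Finset.mul_sum, map_sum]
      exact Finset.sum_eq_single i (fun j _ hj => hoff' i j k hj.symm) (by simp)
    have h2 : ρ (A k * E i) = ρ (E i * A k * E i) := by
      conv_lhs => rw [← one_mul (A k * E i), ← hsumE, Finset.sum_mul, map_sum]
      simp only [← mul_assoc]
      exact Finset.sum_eq_single i (fun j _ hj => hoff' j i k hj) (by simp)
    rw [Commute, SemiconjBy, ← map_mul, ← map_mul, h1, h2]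
  have hEE : ∀ i j, Commute (ρ (E i)) (ρ (E j)) := by
    intro i j
    rw [Commute, SemiconjBy, ← map_mul, ← map_mul]
    congr 1
    refine Subtype.ext ?_
    change Matrix.diagonal _ * Matrix.diagonal _ = Matrix.diagonal _ * Matrix.diagonal _
    simp only [Matrix.diagonal_mul_diagonal, mul_comm]
  have hAA : ∀ i j, Commute (ρ (A i)) (ρ (A j)) := by
    intro i j
    rw [Commute, SemiconjBy, ← map_mul, ← map_mul]
    exact congrArg ρ (Subtype.ext (hcomm i j))
  have hgen : ∀ a ∈ Set.range S.A ∪ Set.range (S.dualIdempotent x),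
      ∀ b ∈ Set.range S.A ∪ Set.range (S.dualIdempotent x),
      ∀ (ha : a ∈ S.terwilligerAlgebra x) (hb : b ∈ S.terwilligerAlgebra x),
      Commute (ρ ⟨a, ha⟩) (ρ ⟨b, hb⟩) := by
    rintro _ (⟨i, rfl⟩ | ⟨i, rfl⟩) _ (⟨j, rfl⟩ | ⟨j, rfl⟩) ha hb
    · exact hAA i j
    · exact (hEA j i).symm
    · exact hEA i j
    · exact hEE i j
  -- Commuting with a fixed endomorphism passes from the generators to the whole algebra.
  have hext : ∀ f : AddMonoid.End M, (∀ b ∈ Set.range S.A ∪ Set.range (S.dualIdempotent x),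
      ∀ hb : b ∈ S.terwilligerAlgebra x, Commute f (ρ ⟨b, hb⟩)) →
      (∀ c : ℂ, Commute f (ρ (algebraMap ℂ _ c))) →
      ∀ t : S.terwilligerAlgebra x, Commute f (ρ t) := by
    rintro f hf hc ⟨t, ht⟩
    have ht' := ht
    rw [terwilligerAlgebra_eq_adjoin] at ht'
    induction ht' using Algebra.adjoin_induction with
    | mem t h => exact hf t h ht
    | algebraMap r => exact hc r
    | add a b ha hb h1 h2 =>
      rw [← terwilligerAlgebra_eq_adjoin] at ha hb
      have : (⟨a + b, ht⟩ : S.terwilligerAlgebra x) = ⟨a, ha⟩ + ⟨b, hb⟩ := rfl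
      rw [this, map_add]
      exact (h1 ha).add_right (h2 hb)
    | mul a b ha hb h1 h2 =>
      rw [← terwilligerAlgebra_eq_adjoin] at ha hb
      have : (⟨a * b, ht⟩ : S.terwilligerAlgebra x) = ⟨a, ha⟩ * ⟨b, hb⟩ := rfl
      rw [this, map_mul]
      exact (h1 ha).mul_right (h2 hb)
  have hscal : ∀ (c : ℂ) (t : S.terwilligerAlgebra x), Commute (ρ t) (ρ (algebraMap ℂ _ c)) := by
    intro c t
    rw [Commute, SemiconjBy, ← map_mul, ← map_mul, Algebra.commutes]
  have hall : Commute (ρ s) (ρ t) :=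
    hext _ (fun b hb hb' => (hext _ (fun a ha ha' => hgen b hb a ha hb' ha')
      (fun c => hscal c _) s).symm) (fun c => hscal c s) t
  exact DFunLike.congr_fun hall m

end Module

/-- A simple module over an algebra that acts through commuting operators has dimension one. -/
theorem finrank_eq_one_of_smul_comm {A M : Type*} [Ring A] [Algebra ℂ A] [FiniteDimensional ℂ A]
    [AddCommGroup M] [Module ℂ M] [Module A M] [IsScalarTower ℂ A M] [IsSimpleModule A M]
    (hcomm : ∀ (s t : A) (m : M), s • t • m = t • s • m) : Module.finrank ℂ M = 1 := by
  have : Nontrivial M := IsSimpleModule.nontrivial A M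
  obtain ⟨v, hv⟩ := exists_ne (0 : M)
  have hfin : FiniteDimensional ℂ M :=
    Module.Finite.of_surjective ((LinearMap.toSpanSingleton A M v).restrictScalars ℂ)
      (IsSimpleModule.toSpanSingleton_surjective A hv)
  let U : Submodule A M := { Submodule.span ℂ {v} with
    smul_mem' a w hw := by
      let f : Module.End A M :=
        { toFun := fun m => a • m
          map_add' := smul_add a
          map_smul' := fun t m => hcomm a t m }
      obtain ⟨c, hc⟩ := (IsSimpleModule.algebraMap_end_bijective_of_isAlgClosed ℂ).2 f
      have h1 : c • w = a • w := DFunLike.congr_fun hc w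
      change a • w ∈ Submodule.span ℂ {v}
      rw [← h1]
      exact Submodule.smul_mem _ _ hw }
  rcases eq_bot_or_eq_top U with hU | hU
  · exact (hv (hU.le (Submodule.mem_span_singleton_self v))).elim
  · rw [finrank_eq_one_iff_of_nonzero v hv, ← top_le_iff]
    exact fun w _ => hU.ge (Submodule.mem_top : w ∈ (⊤ : Submodule A M))

/-- If every off-diagonal block `E_i^* A_k E_j^*` is a multiple of `E_i^* J E_j^*`, then the ideal
spanned by the matrices `E_i^* J E_j^*` either acts nontrivially on an irreducible module, which is
then the primary module, or acts by zero, and then the algebra acts through a commutative quotient.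
-/
theorem isAlmostCommutative_of_offDiagonal.{v} (S : AssociationScheme Ω ι) (x : Ω)
    (hcomm : ∀ i j, S.A i * S.A j = S.A j * S.A i)
    (hoff : ∀ i j k, i ≠ j → ∃ c : ℂ,
      S.dualIdempotent x i * S.A k * S.dualIdempotent x j = c • S.primaryUnit x i j) :
    IsAlmostCommutative.{_, _, v} S x := by
  intro M _ _ _ _ hM hne
  refine finrank_eq_one_of_smul_comm
    (S.smul_comm_of_primaryUnit_smul_eq_zero x hcomm hoff fun i j m => ?_)
  by_contra h
  exact hne (S.nonempty_equiv_primaryModule x hM h)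

end AssociationScheme

section

variable (G : Type*) [Group G] [Fintype G] [DecidableEq G]

theorem groupAdjacency_mul_comm (C D : ConjClasses G) :
    groupAdjacency G C * groupAdjacency G D = groupAdjacency G D * groupAdjacency G C := by
  ext x y
  rw [Matrix.mul_apply, Matrix.mul_apply]
  -- The substitution `z ↦ y z⁻¹ x` replaces `(z x⁻¹, y z⁻¹)` by `(y z⁻¹, z x⁻¹)` up to conjugacy.
  refine Fintype.sum_equiv (((Equiv.inv G).trans (Equiv.mulLeft y)).trans (Equiv.mulRight x)) _ _
    fun z => ?_
  have h1 : ConjClasses.mk (z * x⁻¹) = ConjClasses.mk (y * (y * z⁻¹ * x)⁻¹) :=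
    ConjClasses.mk_eq_mk_iff_isConj.2 (isConj_iff.2 ⟨y * x⁻¹, by group⟩)
  have h2 : y * z⁻¹ * x * x⁻¹ = y * z⁻¹ := by group
  simp only [groupAdjacency, Matrix.of_apply, Equiv.trans_apply, Equiv.inv_apply,
    Equiv.coe_mulLeft, Equiv.coe_mulRight, h1, h2, mul_comm]

/-- If the conjugacy class of `y x⁻¹` depends only on the classes of `x` and `y` whenever these are
distinct, then the Terwilliger algebra of the group scheme is almost commutative. -/
theorem isAlmostCommutative_of_isConj_mul_inv.{v}
    (h : ∀ x x' y y' : G, IsConj x x' → IsConj y y' → ¬ IsConj x y →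
      IsConj (y * x⁻¹) (y' * x'⁻¹)) :
    AssociationScheme.IsAlmostCommutative.{_, _, v} (groupAssociationScheme G) (1 : G) := by
  refine AssociationScheme.isAlmostCommutative_of_offDiagonal _ _
    (groupAdjacency_mul_comm G) fun C D K hCD => ?_
  obtain ⟨x, rfl⟩ := ConjClasses.exists_rep C
  obtain ⟨y, rfl⟩ := ConjClasses.exists_rep D
  refine ⟨if ConjClasses.mk (y * x⁻¹) = K then 1 else 0, ?_⟩
  ext a b
  have hA : ∀ (C : ConjClasses G) (s t : G), (groupAssociationScheme G).A C s t =
    if ConjClasses.mk (t * s⁻¹) = C then 1 else 0 := fun C s t => rfl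
  simp only [AssociationScheme.dualIdempotent, AssociationScheme.primaryUnit,
    Matrix.mul_diagonal, Matrix.diagonal_mul, Matrix.vecMulVec_apply, Matrix.smul_apply,
    smul_eq_mul, hA, inv_one, mul_one]
  by_cases ha : ConjClasses.mk a = ConjClasses.mk x
  · by_cases hb : ConjClasses.mk b = ConjClasses.mk y
    · have h1 : ConjClasses.mk (b * a⁻¹) = ConjClasses.mk (y * x⁻¹) := by
        rw [ConjClasses.mk_eq_mk_iff_isConj] at ha hb ⊢
        refine (h x a y b ha.symm hb.symm fun hxy => hCD ?_).symm
        exact ConjClasses.mk_eq_mk_iff_isConj.2 hxy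
      simp [ha, hb, h1]
    · simp [hb]
  · simp [ha]

end

/-! ### Spaces of alternating forms over a finite field -/

theorem Matrix.dotProduct_mulVec_self_eq_zero {n R : Type*} [Fintype n] [DecidableEq n]
    [CommRing R] {A : Matrix n n R} (hd : ∀ i, A i i = 0) (hs : ∀ i j, A i j + A j i = 0)
    (v : n → R) : v ⬝ᵥ A.mulVec v = 0 := by
  simp only [dotProduct, Matrix.mulVec, Finset.mul_sum]
  rw [← Finset.sum_product']
  refine Finset.sum_involution (fun q _ => q.swap) (fun q _ => ?_) (fun q _ hq h => hq ?_)
    (fun q _ => by simp) (fun q _ => Prod.swap_swap q)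
  · simp only [Prod.fst_swap, Prod.snd_swap]
    linear_combination v q.1 * v q.2 * hs q.1 q.2
  · have : q.2 = q.1 := congrArg Prod.fst h
    rw [this, hd, zero_mul, mul_zero]

/-- The determinant of an alternating matrix over a field is a square, by induction: split off a
hyperbolic plane and pass to its Schur complement, which is again alternating. -/
theorem Matrix.isSquare_det_of_dotProduct_mulVec_self {K : Type*} [Field K] (N : ℕ) :
    ∀ {n : Type} [Fintype n] [DecidableEq n] (A : Matrix n n K), Fintype.card n = N →
      (∀ v, v ⬝ᵥ A.mulVec v = 0) → IsSquare A.det := by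
  induction N using Nat.strong_induction_on with
  | _ N ih =>
    intro n _ _ A hN hA
    by_cases h0 : A = 0
    · subst h0
      rcases isEmpty_or_nonempty n with h | h
      · exact ⟨1, by simp [Matrix.det_isEmpty]⟩
      · exact ⟨0, by simp [Matrix.det_zero]⟩
    have hd : ∀ i, A i i = 0 := fun i => by simpa using hA (Pi.single i 1)
    have hs : ∀ i j, A i j + A j i = 0 := fun i j => by
      have := hA (Pi.single i 1 + Pi.single j 1)
      simp only [Matrix.mulVec_add, dotProduct_add, add_dotProduct, hA] at this
      simpa [add_comm] using this
    obtain ⟨i, j, hij⟩ : ∃ i j, A i j ≠ 0 := by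
      by_contra! h
      exact h0 (Matrix.ext h)
    have hne : i ≠ j := fun h => hij (h ▸ hd i)
    let e₂ : Fin 2 ≃ {k // k = i ∨ k = j} :=
      Equiv.ofBijective ![⟨i, Or.inl rfl⟩, ⟨j, Or.inr rfl⟩] (by
      constructor
      · intro a b hab
        fin_cases a <;> fin_cases b <;> simp_all
      · rintro ⟨k, rfl | rfl⟩
        · exact ⟨0, rfl⟩
        · exact ⟨1, rfl⟩)
    let e : Fin 2 ⊕ {k // ¬ (k = i ∨ k = j)} ≃ n :=
      (Equiv.sumCongr e₂ (Equiv.refl _)).trans (Equiv.sumCompl _)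
    set B := A.submatrix e e with hB
    have hBdet : B.det = A.det := Matrix.det_submatrix_equiv_self e A
    have hBalt : ∀ v, v ⬝ᵥ B.mulVec v = 0 := fun v =>
      Matrix.dotProduct_mulVec_self_eq_zero (A := B) (fun i => hd _) (fun i j => hs _ _) v
    have hBalt' : ∀ v, v ⬝ᵥ (Matrix.fromBlocks B.toBlocks₁₁ B.toBlocks₁₂ B.toBlocks₂₁
        B.toBlocks₂₂).mulVec v = 0 := by
      rw [Matrix.fromBlocks_toBlocks]
      exact hBalt
    have h11 : B.toBlocks₁₁.det = A i j * A i j := by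
      rw [Matrix.det_fin_two]
      change A i i * A j j - A i j * A j i = _
      rw [hd, eq_neg_of_add_eq_zero_right (hs i j)]
      ring
    have hunit : IsUnit B.toBlocks₁₁.det := by
      rw [h11]
      exact (mul_ne_zero hij hij).isUnit
    let := Matrix.invertibleOfIsUnitDet _ hunit
    rw [← hBdet, ← Matrix.fromBlocks_toBlocks B, Matrix.det_fromBlocks₁₁, h11]
    refine IsSquare.mul ⟨_, rfl⟩ (ih _ ?_ _ rfl fun v => ?_)
    · have := Fintype.card_congr e
      rw [Fintype.card_sum, Fintype.card_fin] at this
      omega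
    · have := hBalt' (Sum.elim (-(⅟B.toBlocks₁₁).mulVec (B.toBlocks₁₂.mulVec v)) v)
      rw [Matrix.fromBlocks_mulVec] at this
      have h1 : B.toBlocks₁₁.mulVec (-(⅟B.toBlocks₁₁).mulVec (B.toBlocks₁₂.mulVec v)) +
          B.toBlocks₁₂.mulVec v = 0 := by
        rw [Matrix.mulVec_neg, Matrix.mulVec_mulVec, mul_invOf_self, Matrix.one_mulVec,
          neg_add_cancel]
      simp only [Sum.elim_comp_inl, Sum.elim_comp_inr, h1, sumElim_dotProduct_sumElim,
        dotProduct_zero, zero_add] at this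
      rw [Matrix.sub_mulVec, ← Matrix.mulVec_mulVec, ← Matrix.mulVec_mulVec, sub_eq_neg_add,
        ← Matrix.mulVec_neg]
      exact this

/-- A linear family of alternating forms on `V`, all of whose nonzero members are nondegenerate,
has dimension at most half that of `V`: the Pfaffian of the family is a polynomial of degree
`dim V / 2` without nontrivial zeros, so that the Chevalley–Warning theorem applies. -/
theorem two_mul_finrank_le_of_nondegenerate {F M V : Type*} [Field F] [Finite F]
    [AddCommGroup M] [Module F M] [FiniteDimensional F M]
    [AddCommGroup V] [Module F V] [FiniteDimensional F V]
    (f : M →ₗ[F] V →ₗ[F] V →ₗ[F] F) (halt : ∀ m v, f m v v = 0)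
    (hnd : ∀ m, m ≠ 0 → ∀ v, (∀ w, f m v w = 0) → v = 0) (hV : 0 < Module.finrank F V) :
    2 * Module.finrank F M ≤ Module.finrank F V := by
  classical
  have := Fintype.ofFinite F
  set r := Module.finrank F M
  set N := Module.finrank F V
  by_contra! hlt
  let bM := Module.finBasis F M
  let bV := Module.finBasis F V
  have : Nonempty (Fin N) := ⟨⟨0, hV⟩⟩
  let P : Matrix (Fin N) (Fin N) (MvPolynomial (Fin r) F) := Matrix.of fun i j =>
    ∑ k, MvPolynomial.C (f (bM k) (bV i) (bV j)) * MvPolynomial.X k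
  have hskew : ∀ m v w, f m v w + f m w v = 0 := fun m v w => by
    have := halt m (v + w)
    simpa [halt] using this
  -- The determinant has a polynomial square root, the Pfaffian.
  obtain ⟨g, hg⟩ : ∃ g : MvPolynomial (Fin r) F, g * g = P.det := by
    let K := FractionRing (MvPolynomial (Fin r) F)
    let φ := algebraMap (MvPolynomial (Fin r) F) K
    obtain ⟨g, hg⟩ : IsSquare (φ.mapMatrix P).det := by
      refine Matrix.isSquare_det_of_dotProduct_mulVec_self N _ (Fintype.card_fin N) fun v => ?_
      refine Matrix.dotProduct_mulVec_self_eq_zero (fun i => ?_) (fun i j => ?_) v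
      · simp [P, halt]
      · simp only [P, RingHom.mapMatrix_apply, Matrix.map_apply, Matrix.of_apply]
        rw [← map_add, ← Finset.sum_add_distrib]
        simp only [← add_mul, ← map_add, hskew, map_zero, zero_mul, Finset.sum_const_zero]
    rw [← RingHom.map_det] at hg
    have h2 : g ^ 2 = φ P.det := by rw [hg, sq]
    obtain ⟨g₀, rfl⟩ := IsIntegrallyClosed.exists_algebraMap_eq_of_isIntegral_pow
      (R := MvPolynomial (Fin r) F) two_pos (h2 ▸ isIntegral_algebraMap)
    refine ⟨g₀, IsFractionRing.injective (MvPolynomial (Fin r) F) K ?_⟩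
    rw [map_mul, ← hg]
  have heval : ∀ a : Fin r → F, MvPolynomial.eval a P.det =
      (Matrix.of fun i j => f (∑ k, a k • bM k) (bV i) (bV j)).det := by
    intro a
    rw [RingHom.map_det]
    congr 1
    ext i j
    simp [P, mul_comm]
    rfl
  have hzero : ∀ a : Fin r → F, MvPolynomial.eval a g = 0 ↔ a = 0 := by
    intro a
    have h1 : MvPolynomial.eval a g = 0 ↔ MvPolynomial.eval a P.det = 0 := by
      rw [← hg, map_mul, mul_self_eq_zero]
    rw [h1, heval]
    constructor
    · intro h
      obtain ⟨v, hv0, hv⟩ := Matrix.exists_vecMul_eq_zero_iff.2 h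
      by_contra ha
      have hm : ∑ k, a k • bM k ≠ 0 := fun h => ha (by
        ext k
        exact Fintype.linearIndependent_iff.1 bM.linearIndependent a h k)
      have hv' := hnd _ hm (∑ i, v i • bV i) fun w => by
        have : f (∑ k, a k • bM k) (∑ i, v i • bV i) = 0 := bV.ext fun j => by
          have := congrFun hv j
          simpa [Matrix.vecMul, dotProduct] using this
        rw [this, LinearMap.zero_apply]
      exact hv0 (funext fun i => Fintype.linearIndependent_iff.1 bV.linearIndependent v hv' i)
    · rintro rfl
      have : (Matrix.of fun i j => f (∑ k, (0 : Fin r → F) k • bM k) (bV i) (bV j)) = 0 := by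
        ext i j
        simp
      rw [this, Matrix.det_zero]
  have hdeg : P.det.totalDegree ≤ N := by
    rw [Matrix.det_apply]
    refine (MvPolynomial.totalDegree_finsetSum _ _).trans (Finset.sup_le fun σ _ => ?_)
    refine (MvPolynomial.totalDegree_smul_le _ _).trans
      ((MvPolynomial.totalDegree_finsetProd _ _).trans ?_)
    refine (Finset.sum_le_card_nsmul _ _ 1 fun i _ => ?_).trans (by simp)
    rw [show P (σ i) i =
      ∑ k, MvPolynomial.C (f (bM k) (bV (σ i)) (bV i)) * MvPolynomial.X k from rfl]
    refine (MvPolynomial.totalDegree_finsetSum _ _).trans (Finset.sup_le fun k _ => ?_)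
    refine (MvPolynomial.totalDegree_mul _ _).trans ?_
    simp [MvPolynomial.totalDegree_X]
  have hr : 0 < r := by omega
  have hg0 : g ≠ 0 := by
    rintro rfl
    have := (hzero (fun _ => 1)).1 (by simp)
    simpa using congrFun this ⟨0, hr⟩
  have hgdeg : g.totalDegree < Fintype.card (Fin r) := by
    rw [← hg, MvPolynomial.totalDegree_mul_of_isDomain hg0 hg0] at hdeg
    rw [Fintype.card_fin]
    omega
  obtain ⟨p, hp⟩ := CharP.exists F
  have hdvd := char_dvd_card_solutions p hgdeg
  have hcard : Fintype.card {x : Fin r → F // MvPolynomial.eval x g = 0} = 1 := by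
    rw [Fintype.card_eq_one_iff]
    exact ⟨⟨0, (hzero 0).2 rfl⟩, fun y => Subtype.ext ((hzero y.1).1 y.2)⟩
  rw [hcard, Nat.dvd_one] at hdvd
  exact CharP.char_ne_one F p hdvd

/-! ### Graded Lie brackets of class three -/

theorem two_mul_finrank_le_of_isotropic {F V : Type*} [Field F] [AddCommGroup V] [Module F V]
    [FiniteDimensional F V] (β : V →ₗ[F] V →ₗ[F] F) (hβ : ∀ x, (∀ y, β x y = 0) → x = 0)
    (V₀ : Submodule F V) (h : ∀ x ∈ V₀, ∀ y ∈ V₀, β x y = 0) :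
    2 * Module.finrank F V₀ ≤ Module.finrank F V := by
  have h1 := Subspace.finrank_add_finrank_dualAnnihilator_eq V₀
  let g : V₀ →ₗ[F] V₀.dualAnnihilator := LinearMap.codRestrict _ (β.domRestrict V₀) fun x =>
    (Submodule.mem_dualAnnihilator _).2 fun y hy => h x x.2 y hy
  have hg : Function.Injective g := by
    rw [injective_iff_map_eq_zero]
    intro x hx
    refine Subtype.ext (hβ x fun y => ?_)
    exact LinearMap.congr_fun (congrArg Subtype.val hx) y
  have h2 := LinearMap.finrank_le_finrank_of_injective hg
  omega

section

variable {F V W : Type*} [Field F] [AddCommGroup V] [Module F V] [AddCommGroup W] [Module F W]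

theorem LinearMap.add_swap_eq_zero_of_alternating {b : V →ₗ[F] V →ₗ[F] W}
    (hb : ∀ x, b x x = 0) (x y : V) : b x y + b y x = 0 := by
  simpa [hb] using hb (x + y)

variable [FiniteDimensional F V] [FiniteDimensional F W] [Finite F]

/-- An alternating `b : V × V → W` with `b(x, ·)` onto for every `x ≠ 0` satisfies
`2 dim W ≤ dim V`: the forms `λ ∘ b`, with `λ` a functional on `W`, are nondegenerate. -/
theorem two_mul_finrank_le_of_surjective {b : V →ₗ[F] V →ₗ[F] W}
    (hb : ∀ x, b x x = 0) (hs : ∀ x, x ≠ 0 → Function.Surjective (b x))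
    (hV : 0 < Module.finrank F V) : 2 * Module.finrank F W ≤ Module.finrank F V := by
  rw [← Subspace.dual_finrank_eq (K := F) (V := W)]
  let f : Module.Dual F W →ₗ[F] V →ₗ[F] V →ₗ[F] F :=
    { toFun := fun l => b.compr₂ l
      map_add' := fun _ _ => rfl
      map_smul' := fun _ _ => rfl }
  refine two_mul_finrank_le_of_nondegenerate f (fun l x => ?_) (fun l hl x hx => ?_) hV
  · exact (congrArg l (hb x)).trans (map_zero l)
  · by_contra hx0
    refine hl (LinearMap.ext fun w => ?_)
    obtain ⟨y, rfl⟩ := hs x hx0 w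
    exact hx y

/-- The structure of a graded bracket `V × V → W`, `W × V → F`: the second pairing is nondegenerate
on the side of `W`, and its kernel in `V` is totally isotropic of half the dimension of `V`. -/
theorem finrank_of_class_three {b : V →ₗ[F] V →ₗ[F] W}
    (hb : ∀ x, b x x = 0) (hs : ∀ x, x ≠ 0 → Function.Surjective (b x))
    {ψ : W →ₗ[F] V →ₗ[F] F} (hψ : ψ ≠ 0)
    (J : ∀ x y z, ψ (b x y) z + ψ (b y z) x + ψ (b z x) y = 0) :
    Module.finrank F V = 2 * Module.finrank F W ∧ (∀ w, (∀ x, ψ w x = 0) → w = 0) ∧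
      Module.finrank F (LinearMap.ker ψ.flip) = Module.finrank F W ∧
      ∀ x ∈ LinearMap.ker ψ.flip, ∀ y ∈ LinearMap.ker ψ.flip, b x y = 0 := by
  have hV0 : ∀ x, x ∈ LinearMap.ker ψ.flip ↔ ∀ w, ψ w x = 0 := fun x => by
    rw [LinearMap.mem_ker, LinearMap.ext_iff]
    rfl
  obtain ⟨w₀, z, hz⟩ : ∃ w z, ψ w z ≠ 0 := by
    by_contra! h
    exact hψ (LinearMap.ext fun w => LinearMap.ext fun z => h w z)
  have hz0 : z ≠ 0 := by
    rintro rfl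
    simp at hz
  have hV : 0 < Module.finrank F V := Module.finrank_pos_iff.2 ⟨z, 0, hz0⟩
  have h1 := two_mul_finrank_le_of_surjective hb hs hV
  have h2 := LinearMap.finrank_range_add_finrank_ker ψ
  have h4 : (LinearMap.range ψ).dualCoannihilator = LinearMap.ker ψ.flip := by
    ext x
    rw [Submodule.mem_dualCoannihilator, hV0]
    simp
  have h3 : Module.finrank F (LinearMap.range ψ) + Module.finrank F (LinearMap.ker ψ.flip) =
      Module.finrank F V := by
    rw [← h4]
    exact Subspace.finrank_add_finrank_dualCoannihilator_eq (LinearMap.range ψ)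
  have h5 := two_mul_finrank_le_of_isotropic (b.compr₂ (ψ.flip z)) (fun x hx => by
      by_contra hx0
      obtain ⟨y, rfl⟩ := hs x hx0 w₀
      exact hz (hx y)) (LinearMap.ker ψ.flip) (fun x hx y hy => by
      have := J x y z
      rw [(hV0 x).1 hx, (hV0 y).1 hy] at this
      simpa using this)
  have h6 : ∀ w, (∀ x, ψ w x = 0) → w = 0 := fun w hw => by
    have h0 : Module.finrank F (LinearMap.ker ψ) = 0 := by omega
    rw [Submodule.finrank_eq_zero] at h0
    have : w ∈ LinearMap.ker ψ := LinearMap.mem_ker.2 (LinearMap.ext hw)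
    rwa [h0, Submodule.mem_bot] at this
  refine ⟨by omega, h6, by omega, fun x hx y hy => h6 _ fun z => ?_⟩
  have := J x y z
  rw [(hV0 x).1 hx, (hV0 y).1 hy] at this
  simpa using this

theorem ker_eq_of_class_three {b : V →ₗ[F] V →ₗ[F] W}
    (hb : ∀ x, b x x = 0) (hs : ∀ x, x ≠ 0 → Function.Surjective (b x))
    {ψ : W →ₗ[F] V →ₗ[F] F} (hψ : ψ ≠ 0)
    (J : ∀ x y z, ψ (b x y) z + ψ (b y z) x + ψ (b z x) y = 0) {x : V} (hx0 : x ≠ 0)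
    (hx : ∀ w, ψ w x = 0) : LinearMap.ker (b x) = LinearMap.ker ψ.flip := by
  obtain ⟨h1, -, h3, h4⟩ := finrank_of_class_three hb hs hψ J
  have hx' : x ∈ LinearMap.ker ψ.flip := by
    rw [LinearMap.mem_ker, LinearMap.ext_iff]
    exact hx
  symm
  refine Submodule.eq_of_le_of_finrank_eq (fun y hy => h4 x hx' y hy) ?_
  have h5 := LinearMap.finrank_range_add_finrank_ker (b x)
  rw [LinearMap.range_eq_top.2 (hs x hx0), finrank_top] at h5
  omega

end

/-! ### Graded Lie brackets of class four -/

/-- The inequality of cardinalities behind `finrank_lt_of_double_count`. -/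
theorem not_card_le_of_sq_le {A H Q : ℤ} (hA : 1 ≤ A) (hAH : A ≤ H) (hHQ : H * H ≤ Q) (hQ : 2 ≤ Q) :
    ¬ (Q * Q - A) * (Q - 1) ≤ (Q * Q - 1) * (A * H - A) := by
  intro h
  have h1 : Q * Q - A ≤ (Q + 1) * (A * H - A) := by
    have : (Q * Q - A) * (Q - 1) ≤ ((Q + 1) * (A * H - A)) * (Q - 1) := by linarith
    exact le_of_mul_le_mul_right this (by linarith)
  rcases eq_or_lt_of_le hA with rfl | hA2
  · have h2 : Q - 1 ≤ H - 1 := by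
      have : (Q - 1) * (Q + 1) ≤ (H - 1) * (Q + 1) := by linarith
      exact le_of_mul_le_mul_right this (by linarith)
    nlinarith
  · have h2 : A * H ≤ Q := by nlinarith
    nlinarith

/-- Let `X c`, for `c ∉ V₁`, be subspaces of half the dimension of `V` such that for `x ≠ 0` the `c`
with `x ∈ X c` lie in a subspace whose dimension over `V₁` is at most a quarter of `dim V`.
Counting the pairs `x ∈ X c` shows that `V₁` has dimension more than a quarter of `dim V`. -/
theorem finrank_lt_of_double_count {F V : Type*} [Field F] [Finite F] [AddCommGroup V] [Module F V]
    [FiniteDimensional F V] {m : ℕ} (hm : 0 < m) (hV : Module.finrank F V = 2 * m)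
    (V₁ : Submodule F V) (X D : V → Submodule F V)
    (hXD : ∀ x c, x ∈ X c ↔ c ∈ D x) (hX : ∀ c ∉ V₁, Module.finrank F (X c) = m)
    (hVD : ∀ x, V₁ ≤ D x)
    (hD : ∀ x, x ≠ 0 → 2 * Module.finrank F (D x) ≤ m + 2 * Module.finrank F V₁) :
    m < 2 * Module.finrank F V₁ := by
  classical
  by_contra! hle
  have : Finite V := Module.finite_of_finite F
  have := Fintype.ofFinite F
  have := Fintype.ofFinite V
  set q := Fintype.card F
  have hq : 2 ≤ q := Fintype.one_lt_card
  have hcard : ∀ U : Submodule F V, (Finset.univ.filter (· ∈ U)).card = q ^ Module.finrank F U := by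
    intro U
    rw [← Module.card_eq_pow_finrank (K := F) (V := U), Fintype.card_subtype]
  have hcardV : (Finset.univ : Finset V).card = q ^ (2 * m) := by
    rw [← hV, ← Module.card_eq_pow_finrank (K := F) (V := V), Finset.card_univ]
  set a := Module.finrank F V₁
  have hcount := Finset.sum_card_bipartiteAbove_eq_sum_card_bipartiteBelow
    (s := Finset.univ.filter (· ∉ V₁)) (t := Finset.univ.filter (· ≠ (0 : V)))
    (fun c x => x ∈ X c)
  have hleft : ∀ c ∈ Finset.univ.filter (· ∉ V₁),
      ((Finset.univ.filter (· ≠ (0 : V))).bipartiteAbove (fun c x => x ∈ X c) c).card =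
        q ^ m - 1 := by
    intro c hc
    rw [← hX c (Finset.mem_filter.1 hc).2, ← hcard, ← Finset.card_erase_of_mem (a := (0 : V))
      (by simp)]
    congr 1
    ext x
    simp [Finset.bipartiteAbove, and_comm]
  have hright : ∀ x ∈ Finset.univ.filter (· ≠ (0 : V)),
      ((Finset.univ.filter (· ∉ V₁)).bipartiteBelow (fun c x => x ∈ X c) x).card ≤
        q ^ a * q ^ (m / 2) - q ^ a := by
    intro x hx
    have h1 : (Finset.univ.filter (· ∉ V₁)).bipartiteBelow (fun c x => x ∈ X c) x =
        Finset.univ.filter (· ∈ D x) \ Finset.univ.filter (· ∈ V₁) := by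
      ext c
      simp [Finset.bipartiteBelow, hXD, and_comm]
    rw [h1, Finset.card_sdiff_of_subset, hcard, hcard, ← pow_add]
    · have := hD x (Finset.mem_filter.1 hx).2
      exact Nat.sub_le_sub_right (Nat.pow_le_pow_right (by omega) (by omega)) _
    · intro c hc
      simp only [Finset.mem_filter, Finset.mem_univ, true_and] at hc ⊢
      exact hVD x hc
  rw [Finset.sum_congr rfl hleft, Finset.sum_const, smul_eq_mul] at hcount
  have hle' := hcount.le.trans (Finset.sum_le_card_nsmul _ _ _ hright)
  have hc1 : (Finset.univ.filter (· ∉ V₁)).card = q ^ (2 * m) - q ^ a := by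
    rw [← hcardV, ← hcard V₁, ← Finset.card_sdiff_of_subset (Finset.filter_subset _ _)]
    congr 1
    ext c
    simp
  have hc2 : (Finset.univ.filter (· ≠ (0 : V))).card = q ^ (2 * m) - 1 := by
    rw [← hcardV, ← Finset.card_erase_of_mem (Finset.mem_univ (0 : V))]
    congr 1
    ext c
    simp
  rw [hc1, hc2, smul_eq_mul] at hle'
  have hp : ∀ i, 1 ≤ q ^ i := fun i => Nat.one_le_pow _ _ (by omega)
  have hA : q ^ a ≤ q ^ (2 * m) := Nat.pow_le_pow_right (by omega) (by omega)
  have hAH : q ^ a ≤ q ^ (m / 2) := Nat.pow_le_pow_right (by omega) (by omega)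
  have hHQ : q ^ (m / 2) * q ^ (m / 2) ≤ q ^ m := by
    rw [← pow_add]
    exact Nat.pow_le_pow_right (by omega) (by omega)
  have hQ : 2 ≤ q ^ m := hq.trans (Nat.le_self_pow hm.ne' q)
  refine not_card_le_of_sq_le (A := (q ^ a : ℕ)) (H := (q ^ (m / 2) : ℕ)) (Q := (q ^ m : ℕ))
    (by exact_mod_cast hp a) (by exact_mod_cast hAH) (by exact_mod_cast hHQ)
    (by exact_mod_cast hQ) ?_
  have h1 : q ^ a ≤ q ^ a * q ^ (m / 2) := Nat.le_mul_of_pos_right _ (hp _)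
  have h2 : q ^ (2 * m) = q ^ m * q ^ m := by rw [two_mul, pow_add]
  rw [h2] at hle' hA
  have h3 : 1 ≤ q ^ m * q ^ m := Nat.mul_pos (hp m) (hp m)
  zify [hA, hp m, h1, h3] at hle'
  push_cast
  exact hle'

section

variable {F V W : Type*} [Field F] [AddCommGroup V] [Module F V] [AddCommGroup W] [Module F W]

/-- The radical of a trilinear form in its last variable. -/
def lastRadical (Φ : W →ₗ[F] V →ₗ[F] V →ₗ[F] F) : Submodule F V where
  carrier := {c | ∀ w x, Φ w x c = 0}
  zero_mem' := by simp
  add_mem' ha hb w x := by rw [map_add, ha, hb, add_zero]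
  smul_mem' r c hc w x := by rw [map_smul, hc, smul_zero]

/-- The vectors `c` with `Φ(·, x, c) = 0`. -/
def lastAnnihilator (Φ : W →ₗ[F] V →ₗ[F] V →ₗ[F] F) (x : V) : Submodule F V where
  carrier := {c | ∀ w, Φ w x c = 0}
  zero_mem' := by simp
  add_mem' ha hb w := by rw [map_add, ha, hb, add_zero]
  smul_mem' r c hc w := by rw [map_smul, hc, smul_zero]

/-- The bilinear form `Φ(·, ·, c)`. -/
def evalLast (Φ : W →ₗ[F] V →ₗ[F] V →ₗ[F] F) (c : V) : W →ₗ[F] V →ₗ[F] F :=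
  LinearMap.mk₂ F (fun w x => Φ w x c) (by simp) (by simp) (by simp) (by simp)

theorem evalLast_ne_zero {Φ : W →ₗ[F] V →ₗ[F] V →ₗ[F] F} {c : V} (hc : c ∉ lastRadical Φ) :
    evalLast Φ c ≠ 0 := fun h => hc fun w x => LinearMap.congr_fun (LinearMap.congr_fun h w) x

theorem lastRadical_le_lastAnnihilator (Φ : W →ₗ[F] V →ₗ[F] V →ₗ[F] F) (x : V) :
    lastRadical Φ ≤ lastAnnihilator Φ x := fun _ hc w => hc w x

theorem mem_ker_flip_evalLast {Φ : W →ₗ[F] V →ₗ[F] V →ₗ[F] F} {c x : V} :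
    x ∈ LinearMap.ker (evalLast Φ c).flip ↔ c ∈ lastAnnihilator Φ x := by
  rw [LinearMap.mem_ker, LinearMap.ext_iff]
  rfl

variable [FiniteDimensional F V] [FiniteDimensional F W] [Finite F]

/-- There is no graded bracket of class four whose first two layers are as in a Camina group and
which satisfies the dimension bound `hD`. -/
theorem false_of_class_four (h2 : (2 : F) ≠ 0) {b : V →ₗ[F] V →ₗ[F] W}
    (hb : ∀ x, b x x = 0) (hs : ∀ x, x ≠ 0 → Function.Surjective (b x))
    {Φ : W →ₗ[F] V →ₗ[F] V →ₗ[F] F} {β : W →ₗ[F] W →ₗ[F] F} (hΦ : Φ ≠ 0)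
    (hβ : ∀ w, β w w = 0)
    (J₁ : ∀ w x y, Φ w x y - Φ w y x = β w (b x y))
    (J₂ : ∀ x y z t, Φ (b x y) z t + Φ (b y z) x t + Φ (b z x) y t = 0)
    (hD : ∀ x, x ≠ 0 → 2 * Module.finrank F (lastAnnihilator Φ x) ≤
      Module.finrank F W + 2 * Module.finrank F (lastRadical Φ)) : False := by
  obtain ⟨c₀, hc₀⟩ : ∃ c, c ∉ lastRadical Φ := by
    by_contra! h
    exact hΦ (LinearMap.ext fun w => LinearMap.ext fun x => LinearMap.ext fun c => h c w x)
  have hJ : ∀ c x y z, evalLast Φ c (b x y) z + evalLast Φ c (b y z) x +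
    evalLast Φ c (b z x) y = 0 := fun c x y z => J₂ x y z c
  have h3 := fun c (hc : c ∉ lastRadical Φ) =>
    finrank_of_class_three hb hs (evalLast_ne_zero hc) (hJ c)
  have hker : ∀ c ∉ lastRadical Φ, ∀ x, x ≠ 0 → c ∈ lastAnnihilator Φ x →
      LinearMap.ker (b x) = LinearMap.ker (evalLast Φ c).flip := fun c hc x hx0 hx =>
    ker_eq_of_class_three hb hs (evalLast_ne_zero hc) (hJ c) hx0 hx
  set m := Module.finrank F W
  have hV : Module.finrank F V = 2 * m := (h3 c₀ hc₀).1
  have hm : 0 < m := by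
    by_contra h
    have : Subsingleton W := Module.finrank_zero_iff.1 (Nat.eq_zero_of_not_pos h)
    refine hc₀ fun w x => ?_
    rw [Subsingleton.elim w 0, map_zero]
    rfl
  have hcount := finrank_lt_of_double_count hm hV (lastRadical Φ)
    (fun c => LinearMap.ker (evalLast Φ c).flip) (lastAnnihilator Φ)
    (fun x c => mem_ker_flip_evalLast) (fun c hc => (h3 c hc).2.2.1)
    (lastRadical_le_lastAnnihilator Φ) hD
  set a := Module.finrank F (lastRadical Φ)
  obtain ⟨x, hx, hx0⟩ : ∃ x ∈ lastRadical Φ, x ≠ 0 := by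
    have : lastRadical Φ ≠ ⊥ := fun h => by
      have : a = 0 := Submodule.finrank_eq_zero.2 h
      omega
    exact Submodule.exists_mem_ne_zero_of_ne_bot this
  -- On the radical, `Φ` is expressed through `β`.
  have hΦβ : ∀ y ∈ lastRadical Φ, ∀ w c, Φ w y c = β w (b y c) := fun y hy w c => by
    have := J₁ w y c
    rwa [hy w c, sub_zero] at this
  have hβs := LinearMap.add_swap_eq_zero_of_alternating hβ
  have hbs := LinearMap.add_swap_eq_zero_of_alternating hb
  let R : Submodule F W := LinearMap.ker β.flip
  have hR : ∀ w, w ∈ R ↔ ∀ w', β w' w = 0 := fun w => by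
    rw [LinearMap.mem_ker, LinearMap.ext_iff]
    rfl
  have hDR : ∀ y ∈ lastRadical Φ, lastAnnihilator Φ y = R.comap (b y) := fun y hy => by
    ext c
    rw [Submodule.mem_comap, hR]
    exact forall_congr' fun w => by rw [hΦβ y hy]
  have hfD : Module.finrank F (lastAnnihilator Φ x) = m + Module.finrank F R := by
    have h4 := LinearMap.finrank_range_add_finrank_ker (R.mkQ ∘ₗ b x)
    have h5 := R.finrank_quotient_add_finrank
    have h6 : Function.Surjective (R.mkQ ∘ₗ b x) := (R.mkQ_surjective).comp (hs x hx0)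
    rw [LinearMap.range_eq_top.2 h6, finrank_top, LinearMap.ker_comp, Submodule.ker_mkQ,
      ← hDR x hx] at h4
    omega
  -- The commutation of `y` with `x` forces the annihilator of `x` into that of `y`.
  have hle : ∀ y, y ≠ 0 → b x y = 0 → lastAnnihilator Φ x ≤ lastAnnihilator Φ y := by
    intro y hy0 hxy c hc
    by_cases hc' : c ∈ lastRadical Φ
    · exact lastRadical_le_lastAnnihilator Φ y hc'
    · rw [← mem_ker_flip_evalLast, ← hker c hc' x hx0 hc]
      exact hxy
  have hDx := hD x hx0
  have hρ : Module.finrank F R < m := by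
    by_contra h
    have hRtop : R = ⊤ := Submodule.eq_top_of_finrank_eq
      (le_antisymm (Submodule.finrank_le R) (not_lt.1 h))
    have h4 : lastRadical Φ ≤ LinearMap.ker (evalLast Φ c₀).flip := fun y hy => by
      rw [mem_ker_flip_evalLast, hDR y hy, hRtop]
      trivial
    have h5 := Submodule.finrank_mono h4
    rw [(h3 c₀ hc₀).2.2.1] at h5
    rw [hRtop, finrank_top] at hfD
    omega
  -- The centralizer of `x` in the radical.
  let P : Submodule F (lastRadical Φ) := LinearMap.ker ((b x).domRestrict (lastRadical Φ))
  have hP : a ≤ Module.finrank F P + Module.finrank F R := by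
    have h4 := LinearMap.finrank_range_add_finrank_ker ((b x).domRestrict (lastRadical Φ))
    have h5 : LinearMap.range ((b x).domRestrict (lastRadical Φ)) ≤ R := by
      rintro _ ⟨y, rfl⟩
      have := lastRadical_le_lastAnnihilator Φ x y.2
      rw [hDR x hx] at this
      exact this
    have h6 := Submodule.finrank_mono h5
    change Module.finrank F _ + Module.finrank F P = a at h4
    omega
  obtain ⟨S, hS⟩ := Submodule.exists_isCompl (lastAnnihilator Φ x)
  have hfS := Submodule.finrank_add_eq_of_isCompl hS
  let f : P →ₗ[F] S →ₗ[F] S →ₗ[F] F :=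
    { toFun := fun y => LinearMap.mk₂ F (fun v v' => β (b x v) (b y.1.1 v'))
        (by simp) (by simp) (by simp) (by simp)
      map_add' := fun _ _ => by ext; simp
      map_smul' := fun _ _ => by ext; simp }
  have hf : 2 * Module.finrank F P ≤ Module.finrank F S := by
    refine two_mul_finrank_le_of_nondegenerate f (fun y v => ?_) (fun y hy v hv => ?_) (by omega)
    · have hxy : b x y.1.1 = 0 := y.2
      have h4 := J₂ x y.1.1 v v
      have h5 : b (v : V) x = - b x v := eq_neg_of_add_eq_zero_left (hbs v x)
      rw [hxy, h5, hΦβ x hx, map_neg, LinearMap.neg_apply, LinearMap.neg_apply,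
        hΦβ y.1.1 y.1.2] at h4
      have h6 := hβs (b x v) (b y.1.1 v)
      have h7 : (2 : F) * β (b x v) (b y.1.1 v) = 0 := by
        simp only [map_zero, LinearMap.zero_apply, zero_add] at h4
        linear_combination h6 - h4
      exact (mul_eq_zero.1 h7).resolve_left h2
    · have hy0 : y.1.1 ≠ 0 := fun h => hy (Subtype.ext (Subtype.ext h))
      have h4 : (v : V) ∈ lastAnnihilator Φ x := by
        rw [hDR x hx, Submodule.mem_comap, hR]
        intro w
        obtain ⟨u, rfl⟩ := hs y.1.1 hy0 w
        obtain ⟨d, hd, s, hs', rfl⟩ := Submodule.mem_sup.1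
          (hS.sup_eq_top.ge (Submodule.mem_top : u ∈ ⊤))
        have hd' : b y.1.1 d ∈ R := by
          have := hle y.1.1 hy0 y.2 hd
          rwa [hDR y.1.1 y.1.2] at this
        have h5 : β (b x v) (b y.1.1 s) = 0 := hv ⟨s, hs'⟩
        have h6 := hβs (b x v) (b y.1.1 s)
        have h7 := hβs (b x v) (b y.1.1 d)
        rw [(hR _).1 hd', zero_add] at h7
        rw [h5, zero_add] at h6
        rw [map_add, map_add, LinearMap.add_apply, h7, h6, add_zero]
      exact Subtype.ext (Submodule.disjoint_def.1 hS.disjoint _ h4 v.2)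
  omega

end

/-! ### The lower central series -/

section

open Subgroup
open scoped commutatorElement

/-- The lower central series of `G`, indexed from `lcs G 0 = G`, so that `lcs G 1 = G'`. -/
abbrev lcs (G : Type*) [Group G] (n : ℕ) : Subgroup G := (⊤ : Subgroup G).lowerCentralSeries n

variable {G : Type*} [Group G]

theorem lcs_le {m n : ℕ} (h : m ≤ n) : lcs G n ≤ lcs G m :=
  Subgroup.lowerCentralSeries_antitone _ h

theorem commutator_mem_lcs {k : ℕ} {a : G} (ha : a ∈ lcs G k) (g : G) : ⁅a, g⁆ ∈ lcs G (k + 1) :=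
  Subgroup.commutator_mem_commutator ha (mem_top g)

theorem commutator_mem_lcs' {k : ℕ} {a : G} (ha : a ∈ lcs G k) (g : G) :
    ⁅g, a⁆ ∈ lcs G (k + 1) := by
  rw [← commutatorElement_inv]
  exact inv_mem (commutator_mem_lcs ha g)

theorem commutator_mem_lcs_one (x y : G) : ⁅x, y⁆ ∈ lcs G 1 :=
  commutator_mem_lcs (mem_top x) y

theorem map_lcs {H : Type*} [Group H] {f : G →* H} (hf : Function.Surjective f) (n : ℕ) :
    (lcs G n).map f = lcs H n := by
  rw [lcs, Subgroup.map_lowerCentralSeries, ← MonoidHom.range_eq_map, MonoidHom.range_eq_top.2 hf]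

/-- The three subgroups lemma modulo a normal subgroup. -/
theorem commutator_commutator_le_of_rotate {N H₁ H₂ H₃ : Subgroup G} [N.Normal]
    (h₁ : ⁅⁅H₂, H₃⁆, H₁⁆ ≤ N) (h₂ : ⁅⁅H₃, H₁⁆, H₂⁆ ≤ N) : ⁅⁅H₁, H₂⁆, H₃⁆ ≤ N := by
  have key : ∀ A B C : Subgroup G, ⁅⁅A, B⁆, C⁆ ≤ N ↔
      ⁅⁅A.map (QuotientGroup.mk' N), B.map (QuotientGroup.mk' N)⁆,
        C.map (QuotientGroup.mk' N)⁆ = ⊥ := by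
    intro A B C
    rw [← Subgroup.map_commutator, ← Subgroup.map_commutator, Subgroup.map_eq_bot_iff,
      QuotientGroup.ker_mk']
  rw [key] at *
  exact commutator_commutator_eq_bot_of_rotate h₁ h₂

theorem commutator_lcs_one_lcs_le (k : ℕ) : ⁅lcs G 1, lcs G k⁆ ≤ lcs G (k + 2) := by
  refine commutator_commutator_le_of_rotate ?_ ?_
  · rw [Subgroup.commutator_comm ⊤ (lcs G k)]
    exact le_rfl
  · exact le_rfl

/-- Modulo `lcs G (k + 2)` the commutators `[a, g]` with `a ∈ lcs G k` are central, so `[·, g]` is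
multiplicative on powers of `a`. -/
theorem mk_commutator_pow {k : ℕ} {a : G} (ha : a ∈ lcs G k) (g : G) (n : ℕ) :
    QuotientGroup.mk' (lcs G (k + 2)) ⁅a ^ n, g⁆ =
      QuotientGroup.mk' (lcs G (k + 2)) ⁅a, g⁆ ^ n := by
  have hc : ∀ u ∈ lcs G (k + 1), ∀ h : G, Commute (QuotientGroup.mk' (lcs G (k + 2)) h)
      (QuotientGroup.mk' (lcs G (k + 2)) u) := by
    intro u hu h
    rw [commute_iff_eq, ← commutatorElement_eq_one_iff_mul_comm, ← map_commutatorElement,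
      ← MonoidHom.mem_ker, QuotientGroup.ker_mk']
    exact commutator_mem_lcs' hu h
  induction n with
  | zero => rw [pow_zero, pow_zero, commutatorElement_one_left, map_one]
  | succ n ih =>
    have h1 : ⁅a ^ (n + 1), g⁆ = a * ⁅a ^ n, g⁆ * a⁻¹ * ⁅a, g⁆ := by
      rw [pow_succ', commutatorElement_def, commutatorElement_def, commutatorElement_def]
      group
    rw [h1, map_mul, map_mul, map_mul, (hc _ (commutator_mem_lcs (pow_mem ha n) g) a).eq, map_inv,
      mul_inv_cancel_right, ih, pow_succ]

theorem pow_mem_lcs_succ {p k : ℕ} (h : ∀ a ∈ lcs G k, a ^ p ∈ lcs G (k + 1)) :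
    ∀ a ∈ lcs G (k + 1), a ^ p ∈ lcs G (k + 2) := by
  let f := QuotientGroup.mk' (lcs G (k + 2))
  let T : Subgroup (G ⧸ lcs G (k + 2)) :=
    { carrier := {c | c ∈ Subgroup.center _ ∧ c ^ p = 1}
      one_mem' := ⟨one_mem _, one_pow _⟩
      mul_mem' := fun {a b} ha hb => ⟨mul_mem ha.1 hb.1, by
        rw [Commute.mul_pow ((Subgroup.mem_center_iff.1 hb.1 a)), ha.2, hb.2, one_mul]⟩
      inv_mem' := fun {a} ha => ⟨inv_mem ha.1, by rw [inv_pow, ha.2, inv_one]⟩ }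
  have hT : lcs G (k + 1) ≤ T.comap f := by
    refine Subgroup.commutator_le.2 fun a ha g _ => ⟨?_, ?_⟩
    · rw [Subgroup.mem_center_iff]
      intro q
      obtain ⟨q, rfl⟩ := QuotientGroup.mk'_surjective _ q
      rw [← commutatorElement_eq_one_iff_mul_comm, ← map_commutatorElement, ← MonoidHom.mem_ker,
        QuotientGroup.ker_mk']
      exact commutator_mem_lcs' (commutator_mem_lcs ha g) q
    · rw [← mk_commutator_pow ha, ← MonoidHom.mem_ker, QuotientGroup.ker_mk']
      exact commutator_mem_lcs (h a ha) g
  intro a ha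
  have := (hT ha).2
  rwa [← map_pow, ← MonoidHom.mem_ker, QuotientGroup.ker_mk'] at this

theorem lcs_eq_bot_of_eq_succ [Group.IsNilpotent G] {k : ℕ} (h : lcs G k ≤ lcs G (k + 1)) :
    lcs G k = ⊥ := by
  have h1 : ∀ n, lcs G k ≤ lcs G (k + n) := by
    intro n
    induction n with
    | zero => exact le_rfl
    | succ n ih => exact h.trans (Subgroup.commutator_mono ih le_rfl)
  obtain ⟨n, hn⟩ := Subgroup.nilpotent_iff_lowerCentralSeries.1 ‹Group.IsNilpotent G›
  rw [eq_bot_iff]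
  exact (h1 n).trans ((lcs_le (Nat.le_add_left n k)).trans hn.le)

theorem lcs_eq_bot_of_quotient [Group.IsNilpotent G] {k : ℕ}
    (h : lcs (G ⧸ lcs G (k + 1)) k = ⊥) : lcs G k = ⊥ := by
  refine lcs_eq_bot_of_eq_succ ?_
  rwa [← map_lcs (QuotientGroup.mk'_surjective _), Subgroup.map_eq_bot_iff,
    QuotientGroup.ker_mk'] at h

/-! ### Camina groups -/

/-- The commutator form of the Camina condition: `g ↦ [x, g]` maps onto `G'` for `x ∉ G'`. -/
def CommutatorsFillDerived (G : Type*) [Group G] : Prop :=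
  ∀ x ∉ lcs G 1, ∀ z ∈ lcs G 1, ∃ g, ⁅x, g⁆ = z

theorem IsCaminaGroup.commutatorsFillDerived (hG : IsCaminaGroup G) :
    CommutatorsFillDerived G := by
  intro x hx z hz
  -- The Camina condition is used for `x⁻¹`, since `x * (g * x⁻¹ * g⁻¹) = [x, g]`.
  have hx' : x⁻¹ ∉ lcs G 1 := fun h => hx (by simpa using inv_mem h)
  have hdisj : Disjoint (ConjClasses.mk x⁻¹).carrier (commutator G : Set G) := by
    rw [Set.disjoint_left]
    intro y hy hy'
    rw [ConjClasses.mem_carrier_iff_mk_eq, ConjClasses.mk_eq_mk_iff_isConj, isConj_iff] at hy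
    obtain ⟨c, hc⟩ := hy
    apply hx'
    rw [← hc]
    exact Normal.conj_mem inferInstance y hy' c
  obtain ⟨g, hg⟩ := hG _ hdisj
  have h1 : x⁻¹ ∈ g • (commutator G : Set G) := by
    rw [← hg]
    exact ConjClasses.mem_carrier_mk
  rw [Set.mem_smul_set_iff_inv_smul_mem, smul_eq_mul, SetLike.mem_coe] at h1
  have h2 : x⁻¹ * z ∈ g • (commutator G : Set G) := by
    rw [Set.mem_smul_set_iff_inv_smul_mem, smul_eq_mul, ← mul_assoc]
    exact mul_mem h1 hz
  rw [← hg, ConjClasses.mem_carrier_iff_mk_eq, ConjClasses.mk_eq_mk_iff_isConj, isConj_comm,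
    isConj_iff] at h2
  obtain ⟨c, hc⟩ := h2
  refine ⟨c, ?_⟩
  rw [commutatorElement_def, mul_assoc, mul_assoc, ← mul_assoc c, hc, mul_inv_cancel_left]

theorem CommutatorsFillDerived.of_surjective (hG : CommutatorsFillDerived G) {H : Type*} [Group H]
    {f : G →* H} (hf : Function.Surjective f) : CommutatorsFillDerived H := by
  intro x hx z hz
  rw [← map_lcs hf] at hx hz
  obtain ⟨x, rfl⟩ := hf x
  obtain ⟨z, hz, rfl⟩ := hz
  obtain ⟨g, rfl⟩ := hG x (fun h => hx ⟨x, h, rfl⟩) z hz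
  exact ⟨f g, (map_commutatorElement f x g).symm⟩

variable {p : ℕ}

/-- The first two factors of the lower central series of a Camina `p`-group have exponent `p`. -/
theorem CommutatorsFillDerived.pow_mem_lcs (hG : CommutatorsFillDerived G) (hp : IsPGroup p G)
    (h12 : ¬ lcs G 1 ≤ lcs G 2) (x : G) : x ^ p ∈ lcs G 1 := by
  obtain ⟨y, hy, hyp⟩ : ∃ y ∉ lcs G 1, y ^ p ∈ lcs G 1 := by
    obtain ⟨y, hy⟩ : ∃ y, y ∉ lcs G 1 := by
      by_contra! h
      have htop : lcs G 1 = ⊤ := (Subgroup.eq_top_iff' _).2 h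
      refine h12 (le_of_eq ?_)
      change _ = ⁅lcs G 1, ⊤⁆
      rw [htop]
      exact htop.symm
    classical
    have hex : ∃ k, y ^ p ^ k ∈ lcs G 1 := by
      obtain ⟨k, hk⟩ := hp y
      exact ⟨k, hk ▸ one_mem _⟩
    obtain ⟨j, hj⟩ : ∃ j, Nat.find hex = j + 1 := Nat.exists_eq_succ_of_ne_zero fun h => hy (by
      have h1 := Nat.find_spec hex
      rwa [h, pow_zero, pow_one] at h1)
    refine ⟨y ^ p ^ j, Nat.find_min hex (by omega), ?_⟩
    rw [← pow_mul, ← pow_succ, ← hj]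
    exact Nat.find_spec hex
  have hexp : ∀ z ∈ lcs G 1, z ^ p ∈ lcs G 2 := by
    intro z hz
    obtain ⟨g, rfl⟩ := hG y hy z hz
    have h1 := mk_commutator_pow (k := 0) (mem_top y) g p
    rw [← map_pow, (MonoidHom.mem_ker.1 (?_ : ⁅y ^ p, g⁆ ∈ (QuotientGroup.mk' (lcs G 2)).ker)),
      eq_comm, ← MonoidHom.mem_ker, QuotientGroup.ker_mk'] at h1
    · exact h1
    · rw [QuotientGroup.ker_mk']
      exact commutator_mem_lcs hyp g
  by_contra hx
  refine h12 fun z hz => ?_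
  obtain ⟨g, rfl⟩ := hG _ hx z hz
  have h1 := mk_commutator_pow (k := 0) (mem_top x) g p
  rw [← map_pow, (MonoidHom.mem_ker.1 (?_ : ⁅x, g⁆ ^ p ∈ (QuotientGroup.mk' (lcs G 2)).ker)),
    ← MonoidHom.mem_ker, QuotientGroup.ker_mk'] at h1
  · exact h1
  · rw [QuotientGroup.ker_mk']
    exact hexp _ (commutator_mem_lcs_one x g)

theorem CommutatorsFillDerived.pow_mem_lcs_of_mem (hG : CommutatorsFillDerived G)
    (hp : IsPGroup p G) (h12 : ¬ lcs G 1 ≤ lcs G 2) (k : ℕ) :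
    ∀ a ∈ lcs G k, a ^ p ∈ lcs G (k + 1) := by
  induction k with
  | zero => exact fun x _ => hG.pow_mem_lcs hp h12 x
  | succ k ih => exact pow_mem_lcs_succ ih

/-! ### Elementary abelian sections and invariant homomorphisms -/

/-- `π : G → A` restricts to a surjective homomorphism from `H` to the additive group `A`, with
kernel `K`; its values outside `H` are irrelevant. -/
structure IsSection (H K : Subgroup G) {A : Type*} [AddCommGroup A] (π : G → A) : Prop where
  map_mul : ∀ a ∈ H, ∀ b ∈ H, π (a * b) = π a + π b
  eq_zero_iff : ∀ a ∈ H, π a = 0 ↔ a ∈ K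
  surj : ∀ v, ∃ a ∈ H, π a = v

/-- `μ : G → A` restricts to a `G`-invariant homomorphism from `N` to the additive group `A`; its
values outside `N` are irrelevant. -/
structure IsInvariantHom (N : Subgroup G) {A : Type*} [AddCommGroup A] (μ : G → A) : Prop where
  map_mul : ∀ a ∈ N, ∀ b ∈ N, μ (a * b) = μ a + μ b
  map_conj : ∀ g, ∀ a ∈ N, μ (g * a * g⁻¹) = μ a

theorem exists_isSection {G : Type u} [Group G] {H K : Subgroup G} [Finite G] (hHH : ⁅H, H⁆ ≤ K)
    (hp : ∀ a ∈ H, a ^ p ∈ K) :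
    ∃ (A : Type u) (_ : AddCommGroup A) (_ : Module (ZMod p) A) (_ : Finite A) (π : G → A),
      IsSection H K π := by
  classical
  let L := K.subgroupOf H
  have hcomm : ∀ a b : H, ⁅a, b⁆ ∈ L := fun a b => hHH (commutator_mem_commutator a.2 b.2)
  have hL : L.Normal := ⟨fun n hn g => by
    have := mul_mem (hcomm g n) hn
    rwa [commutatorElement_def, inv_mul_cancel_right] at this⟩
  let cg : CommGroup (H ⧸ L) :=
    { (inferInstance : Group (H ⧸ L)) with
      mul_comm := fun a b => by
        obtain ⟨a, rfl⟩ := QuotientGroup.mk'_surjective L a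
        obtain ⟨b, rfl⟩ := QuotientGroup.mk'_surjective L b
        rw [← commutatorElement_eq_one_iff_mul_comm, ← map_commutatorElement, ← MonoidHom.mem_ker,
          QuotientGroup.ker_mk']
        exact hcomm a b }
  let A := Additive (H ⧸ L)
  have hpA : ∀ a : A, p • a = 0 := fun a => by
    obtain ⟨a, rfl⟩ := QuotientGroup.mk'_surjective L a
    change (QuotientGroup.mk' L a) ^ p = 1
    rw [← map_pow, ← MonoidHom.mem_ker, QuotientGroup.ker_mk']
    exact hp a a.2
  let md : Module (ZMod p) A := AddCommGroup.zmodModule hpA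
  let π : G → A := fun g => if h : g ∈ H then Additive.ofMul (QuotientGroup.mk' L ⟨g, h⟩) else 0
  have hπ : ∀ a (ha : a ∈ H), π a = Additive.ofMul (QuotientGroup.mk' L ⟨a, ha⟩) :=
    fun a ha => dif_pos ha
  refine ⟨A, inferInstance, md, inferInstanceAs (Finite (H ⧸ L)), π, ⟨fun a ha b hb => ?_,
    fun a ha => ?_, fun v => ?_⟩⟩
  · rw [hπ _ (mul_mem ha hb), hπ a ha, hπ b hb]
    rfl
  · rw [hπ a ha]
    change QuotientGroup.mk' L ⟨a, ha⟩ = 1 ↔ _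
    rw [← MonoidHom.mem_ker, QuotientGroup.ker_mk', Subgroup.mem_subgroupOf]
  · obtain ⟨a, ha⟩ := QuotientGroup.mk'_surjective L v
    exact ⟨a, a.2, (hπ a a.2).trans ha⟩

namespace IsInvariantHom

variable {N : Subgroup G} {A : Type*} [AddCommGroup A] {μ : G → A}

theorem map_one (hμ : IsInvariantHom N μ) : μ 1 = 0 := by
  simpa using hμ.map_mul 1 (one_mem N) 1 (one_mem N)

theorem map_inv (hμ : IsInvariantHom N μ) {a : G} (ha : a ∈ N) : μ a⁻¹ = -μ a := by
  rw [eq_neg_iff_add_eq_zero, ← hμ.map_mul _ (inv_mem ha) _ ha, inv_mul_cancel, hμ.map_one]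

theorem map_commutator_swap (hμ : IsInvariantHom N μ) {a b : G} (h : ⁅a, b⁆ ∈ N) :
    μ ⁅b, a⁆ = -μ ⁅a, b⁆ := by
  rw [← commutatorElement_inv, hμ.map_inv h]

theorem map_mul_commutator (hμ : IsInvariantHom N μ) [N.Normal] {a b c : G} (ha : ⁅a, c⁆ ∈ N)
    (hb : ⁅b, c⁆ ∈ N) : μ ⁅a * b, c⁆ = μ ⁅a, c⁆ + μ ⁅b, c⁆ := by
  have h : ⁅a * b, c⁆ = (a * ⁅b, c⁆ * a⁻¹) * ⁅a, c⁆ := by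
    simp only [commutatorElement_def]
    group
  rw [h, hμ.map_mul _ (Normal.conj_mem inferInstance _ hb a) _ ha, hμ.map_conj _ _ hb, add_comm]

theorem map_commutator_mul (hμ : IsInvariantHom N μ) [N.Normal] {a b c : G} (hb : ⁅a, b⁆ ∈ N)
    (hc : ⁅a, c⁆ ∈ N) : μ ⁅a, b * c⁆ = μ ⁅a, b⁆ + μ ⁅a, c⁆ := by
  have h : ⁅a, b * c⁆ = ⁅a, b⁆ * (b * ⁅a, c⁆ * b⁻¹) := by
    simp only [commutatorElement_def]
    group
  rw [h, hμ.map_mul _ hb _ (Normal.conj_mem inferInstance _ hc b), hμ.map_conj _ _ hc]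

/-- An invariant homomorphism on `lcs G k` vanishes on `lcs G (k + 1)`. -/
theorem eq_zero_of_mem {k : ℕ} (hμ : IsInvariantHom (lcs G k) μ) {a : G}
    (ha : a ∈ lcs G (k + 1)) : μ a = 0 := by
  let T : Subgroup G :=
    { carrier := {a | a ∈ lcs G k ∧ μ a = 0}
      one_mem' := ⟨one_mem _, hμ.map_one⟩
      mul_mem' := fun ha hb => ⟨mul_mem ha.1 hb.1, by
        rw [hμ.map_mul _ ha.1 _ hb.1, ha.2, hb.2, add_zero]⟩
      inv_mem' := fun ha => ⟨inv_mem ha.1, by rw [hμ.map_inv ha.1, ha.2, neg_zero]⟩ }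
  have hT : lcs G (k + 1) ≤ T := Subgroup.commutator_le.2 fun b hb g _ =>
    ⟨lcs_le (Nat.le_succ k) (commutator_mem_lcs hb g), by
      have h : ⁅b, g⁆ = b * (g * b⁻¹ * g⁻¹) := by
        simp only [commutatorElement_def]
        group
      rw [h, hμ.map_mul _ hb _ (Normal.conj_mem inferInstance _ (inv_mem hb) g),
        hμ.map_conj _ _ (inv_mem hb), hμ.map_inv hb, add_neg_cancel]⟩
  exact (hT ha).2

theorem eq_zero_of_forall_commutator {k : ℕ} (hμ : IsInvariantHom (lcs G (k + 1)) μ)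
    (h : ∀ a ∈ lcs G k, ∀ g, μ ⁅a, g⁆ = 0) {a : G} (ha : a ∈ lcs G (k + 1)) : μ a = 0 := by
  let T : Subgroup G :=
    { carrier := {a | a ∈ lcs G (k + 1) ∧ μ a = 0}
      one_mem' := ⟨one_mem _, hμ.map_one⟩
      mul_mem' := fun ha hb => ⟨mul_mem ha.1 hb.1, by
        rw [hμ.map_mul _ ha.1 _ hb.1, ha.2, hb.2, add_zero]⟩
      inv_mem' := fun ha => ⟨inv_mem ha.1, by rw [hμ.map_inv ha.1, ha.2, neg_zero]⟩ }
  have hT : lcs G (k + 1) ≤ T := Subgroup.commutator_le.2 fun b hb g _ =>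
    ⟨commutator_mem_lcs hb g, h b hb g⟩
  exact (hT ha).2

/-- Bracketing with a fixed element lowers the degree of an invariant homomorphism by one. -/
theorem commutator {k : ℕ} (hμ : IsInvariantHom (lcs G (k + 1)) μ) (c : G) :
    IsInvariantHom (lcs G k) fun u => μ ⁅u, c⁆ where
  map_mul _ ha _ hb := hμ.map_mul_commutator (commutator_mem_lcs ha c) (commutator_mem_lcs hb c)
  map_conj g a ha := by
    have h : g * a * g⁻¹ = ⁅g, a⁆ * a := by rw [commutatorElement_def, inv_mul_cancel_right]
    have hga := commutator_mem_lcs' ha g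
    rw [h, hμ.map_mul_commutator (lcs_le (Nat.le_succ _) (commutator_mem_lcs hga c))
      (commutator_mem_lcs ha c), hμ.eq_zero_of_mem (commutator_mem_lcs hga c), zero_add]

/-- The Hall–Witt identity under an invariant homomorphism. -/
theorem hall_witt (hμ : IsInvariantHom N μ) [N.Normal] {x y z : G}
    (hx : ⁅x⁻¹, ⁅y⁻¹, z⁆⁆ ∈ N) (hy : ⁅y, ⁅z⁻¹, x⁻¹⁆⁆ ∈ N) :
    μ ⁅z, ⁅x, y⁆⁆ + μ ⁅y, ⁅z⁻¹, x⁻¹⁆⁆ + μ ⁅x⁻¹, ⁅y⁻¹, z⁆⁆ = 0 := by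
  have h : ⁅z, ⁅x, y⁆⁆ = (x * z) * ⁅y, ⁅z⁻¹, x⁻¹⁆⁆⁻¹ * (x * z)⁻¹ *
      ((x * y) * ⁅x⁻¹, ⁅y⁻¹, z⁆⁆⁻¹ * (x * y)⁻¹) := by
    simp only [commutatorElement_def]
    group
  rw [h, hμ.map_mul _ (Normal.conj_mem inferInstance _ (inv_mem hy) _) _
    (Normal.conj_mem inferInstance _ (inv_mem hx) _), hμ.map_conj _ _ (inv_mem hy),
    hμ.map_conj _ _ (inv_mem hx), hμ.map_inv hy, hμ.map_inv hx]
  abel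

end IsInvariantHom

namespace IsSection

variable {H K : Subgroup G} {A : Type*} [AddCommGroup A] [Module (ZMod p) A] {π : G → A}
  {Z : Type*} [AddCommGroup Z] [Module (ZMod p) Z]

theorem map_one (hπ : IsSection H K π) : π 1 = 0 := by
  simpa using hπ.map_mul 1 (one_mem H) 1 (one_mem H)

theorem map_inv (hπ : IsSection H K π) {a : G} (ha : a ∈ H) : π a⁻¹ = -π a := by
  rw [eq_neg_iff_add_eq_zero, ← hπ.map_mul _ (inv_mem ha) _ ha, inv_mul_cancel, hπ.map_one]

theorem exists_linearMap (hπ : IsSection H K π) (f : G → Z)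
    (hf : ∀ a ∈ H, ∀ b ∈ H, f (a * b) = f a + f b) (hK : ∀ a ∈ H, a ∈ K → f a = 0) :
    ∃ φ : A →ₗ[ZMod p] Z, ∀ a ∈ H, φ (π a) = f a := by
  choose s hsH hs using hπ.surj
  have hwd : ∀ a ∈ H, f (s (π a)) = f a := by
    intro a ha
    have h1 : a * (a⁻¹ * s (π a)) = s (π a) := mul_inv_cancel_left _ _
    have h2 : a⁻¹ * s (π a) ∈ H := mul_mem (inv_mem ha) (hsH _)
    rw [← h1, hf _ ha _ h2, hK _ h2, add_zero]
    rw [← hπ.eq_zero_iff _ h2, hπ.map_mul _ (inv_mem ha) _ (hsH _), hπ.map_inv ha, hs,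
      neg_add_cancel]
  let φ : A →+ Z := AddMonoidHom.mk' (fun v => f (s v)) fun v w => by
    have h1 : v + w = π (s v * s w) := by rw [hπ.map_mul _ (hsH v) _ (hsH w), hs, hs]
    rw [h1, hwd _ (mul_mem (hsH v) (hsH w)), hf _ (hsH v) _ (hsH w)]
  exact ⟨φ.toZModLinearMap p, hwd⟩

variable {H' K' : Subgroup G} {B : Type*} [AddCommGroup B] [Module (ZMod p) B] {π' : G → B}

theorem exists_bilinear (hπ : IsSection H K π) (hπ' : IsSection H' K' π') (f : G → G → Z)
    (h₁ : ∀ b ∈ H', ∀ a ∈ H, ∀ a' ∈ H, f (a * a') b = f a b + f a' b)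
    (h₂ : ∀ a ∈ H, ∀ b ∈ H', ∀ b' ∈ H', f a (b * b') = f a b + f a b')
    (hK : ∀ b ∈ H', ∀ a ∈ H, a ∈ K → f a b = 0)
    (hK' : ∀ a ∈ H, ∀ b ∈ H', b ∈ K' → f a b = 0) :
    ∃ φ : A →ₗ[ZMod p] B →ₗ[ZMod p] Z, ∀ a ∈ H, ∀ b ∈ H', φ (π a) (π' b) = f a b := by
  have h : ∀ a, ∃ φ : B →ₗ[ZMod p] Z, a ∈ H → ∀ b ∈ H', φ (π' b) = f a b := by
    intro a
    by_cases ha : a ∈ H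
    · obtain ⟨φ, hφ⟩ := hπ'.exists_linearMap (p := p) (f a) (h₂ a ha) (hK' a ha)
      exact ⟨φ, fun _ => hφ⟩
    · exact ⟨0, fun h => (ha h).elim⟩
  choose g hg using h
  have hext : ∀ φ ψ : B →ₗ[ZMod p] Z, (∀ b ∈ H', φ (π' b) = ψ (π' b)) → φ = ψ := by
    intro φ ψ h
    ext v
    obtain ⟨b, hb, rfl⟩ := hπ'.surj v
    exact h b hb
  obtain ⟨φ, hφ⟩ := hπ.exists_linearMap (p := p) g
    (fun a ha a' ha' => hext _ _ fun b hb => by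
      rw [LinearMap.add_apply, hg _ (mul_mem ha ha') b hb, hg a ha b hb, hg a' ha' b hb,
        h₁ b hb a ha a' ha'])
    (fun a ha haK => hext _ _ fun b hb => by
      rw [hg a ha b hb, hK b hb a ha haK, LinearMap.zero_apply])
  exact ⟨φ, fun a ha b hb => by rw [hφ a ha, hg a ha b hb]⟩

variable {H'' K'' : Subgroup G} {C : Type*} [AddCommGroup C] [Module (ZMod p) C] {π'' : G → C}

theorem exists_trilinear (hπ : IsSection H K π) (hπ' : IsSection H' K' π')
    (hπ'' : IsSection H'' K'' π'') (f : G → G → G → Z)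
    (h₁ : ∀ b ∈ H', ∀ c ∈ H'', ∀ a ∈ H, ∀ a' ∈ H, f (a * a') b c = f a b c + f a' b c)
    (h₂ : ∀ a ∈ H, ∀ c ∈ H'', ∀ b ∈ H', ∀ b' ∈ H', f a (b * b') c = f a b c + f a b' c)
    (h₃ : ∀ a ∈ H, ∀ b ∈ H', ∀ c ∈ H'', ∀ c' ∈ H'', f a b (c * c') = f a b c + f a b c')
    (hK : ∀ b ∈ H', ∀ c ∈ H'', ∀ a ∈ H, a ∈ K → f a b c = 0)
    (hK' : ∀ a ∈ H, ∀ c ∈ H'', ∀ b ∈ H', b ∈ K' → f a b c = 0)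
    (hK'' : ∀ a ∈ H, ∀ b ∈ H', ∀ c ∈ H'', c ∈ K'' → f a b c = 0) :
    ∃ φ : A →ₗ[ZMod p] B →ₗ[ZMod p] C →ₗ[ZMod p] Z,
      ∀ a ∈ H, ∀ b ∈ H', ∀ c ∈ H'', φ (π a) (π' b) (π'' c) = f a b c := by
  have h : ∀ a, ∃ φ : B →ₗ[ZMod p] C →ₗ[ZMod p] Z,
      a ∈ H → ∀ b ∈ H', ∀ c ∈ H'', φ (π' b) (π'' c) = f a b c := by
    intro a
    by_cases ha : a ∈ H
    · obtain ⟨φ, hφ⟩ := hπ'.exists_bilinear (p := p) hπ'' (f a) (h₂ a ha) (h₃ a ha)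
        (hK' a ha) (hK'' a ha)
      exact ⟨φ, fun _ => hφ⟩
    · exact ⟨0, fun h => (ha h).elim⟩
  choose g hg using h
  have hext : ∀ φ ψ : B →ₗ[ZMod p] C →ₗ[ZMod p] Z,
      (∀ b ∈ H', ∀ c ∈ H'', φ (π' b) (π'' c) = ψ (π' b) (π'' c)) → φ = ψ := by
    intro φ ψ h
    ext v w
    obtain ⟨b, hb, rfl⟩ := hπ'.surj v
    obtain ⟨c, hc, rfl⟩ := hπ''.surj w
    exact h b hb c hc
  obtain ⟨φ, hφ⟩ := hπ.exists_linearMap (p := p) g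
    (fun a ha a' ha' => hext _ _ fun b hb c hc => by
      rw [LinearMap.add_apply, LinearMap.add_apply, hg _ (mul_mem ha ha') b hb c hc,
        hg a ha b hb c hc, hg a' ha' b hb c hc, h₁ b hb c hc a ha a' ha'])
    (fun a ha haK => hext _ _ fun b hb c hc => by
      rw [hg a ha b hb c hc, hK b hb c hc a ha haK, LinearMap.zero_apply, LinearMap.zero_apply])
  exact ⟨φ, fun a ha b hb c hc => by rw [hφ a ha, hg a ha b hb c hc]⟩

/-- A submodule of a section of `G` is again a section. -/
theorem exists_restrict (hπ : IsSection (⊤ : Subgroup G) K π) (U : Submodule (ZMod p) A) :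
    ∃ (H : Subgroup G) (ρ : G → U), IsSection H K ρ ∧ (∀ g, g ∈ H ↔ π g ∈ U) ∧
      ∀ g ∈ H, (ρ g : A) = π g := by
  classical
  let H : Subgroup G :=
    { carrier := {g | π g ∈ U}
      one_mem' := by
        change π 1 ∈ U
        rw [hπ.map_one]
        exact zero_mem U
      mul_mem' := fun {a b} ha hb => by
        change π (a * b) ∈ U
        rw [hπ.map_mul a (mem_top a) b (mem_top b)]
        exact add_mem ha hb
      inv_mem' := fun {a} ha => by
        change π a⁻¹ ∈ U
        rw [hπ.map_inv (mem_top a)]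
        exact neg_mem ha }
  let ρ : G → U := fun g => if h : π g ∈ U then ⟨π g, h⟩ else 0
  have hρ : ∀ g ∈ H, (ρ g : A) = π g := fun g hg => by
    have : ρ g = ⟨π g, hg⟩ := dif_pos hg
    rw [this]
  refine ⟨H, ρ, ⟨fun a ha b hb => Subtype.ext ?_, fun a ha => ?_, fun v => ?_⟩,
    fun g => Iff.rfl, hρ⟩
  · rw [Submodule.coe_add, hρ _ (mul_mem ha hb), hρ a ha, hρ b hb,
      hπ.map_mul a (mem_top a) b (mem_top b)]
  · rw [← hπ.eq_zero_iff a (mem_top a), ← hρ a ha, Submodule.coe_eq_zero]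
  · obtain ⟨a, -, ha⟩ := hπ.surj v
    have haH : a ∈ H := by
      change π a ∈ U
      rw [ha]
      exact v.2
    exact ⟨a, haH, Subtype.ext ((hρ a haH).trans ha)⟩

end IsSection

end

section

open Subgroup
open scoped commutatorElement

/-! ### The first two layers of a Camina group -/

/-- The sections `V = G / G'` and `W = G' / [G', G]` as vector spaces over `ZMod p`, with the
commutator bracket `V × V → W`. -/
structure LowerLayers (p : ℕ) (G : Type u) [Group G] where
  /-- the section `G / G'` -/
  V : Type u
  /-- the section `G' / [G', G]` -/
  W : Type u
  [acgV : AddCommGroup V]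
  [acgW : AddCommGroup W]
  [modV : Module (ZMod p) V]
  [modW : Module (ZMod p) W]
  [finV : Finite V]
  [finW : Finite W]
  /-- the projection onto `V` -/
  πV : G → V
  /-- the projection onto `W` -/
  πW : G → W
  isSectionV : IsSection (⊤ : Subgroup G) (lcs G 1) πV
  isSectionW : IsSection (lcs G 1) (lcs G 2) πW
  /-- the commutator bracket -/
  b : V →ₗ[ZMod p] V →ₗ[ZMod p] W
  b_apply : ∀ x y, b (πV x) (πV y) = πW ⁅x, y⁆

attribute [instance] LowerLayers.acgV LowerLayers.acgW LowerLayers.modV LowerLayers.modW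
  LowerLayers.finV LowerLayers.finW

variable {p : ℕ} {G : Type u} [Group G]

theorem IsSection.isInvariantHom {k : ℕ} {A : Type*} [AddCommGroup A] {π : G → A}
    (hπ : IsSection (lcs G k) (lcs G (k + 1)) π) : IsInvariantHom (lcs G k) π where
  map_mul := hπ.map_mul
  map_conj g a ha := by
    have h : g * a * g⁻¹ = ⁅g, a⁆ * a := by rw [commutatorElement_def, inv_mul_cancel_right]
    have hga := commutator_mem_lcs' ha g
    rw [h, hπ.map_mul _ (lcs_le (Nat.le_succ k) hga) _ ha,
      (hπ.eq_zero_iff _ (lcs_le (Nat.le_succ k) hga)).2 hga, zero_add]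

theorem CommutatorsFillDerived.nonempty_lowerLayers [Finite G] (hG : CommutatorsFillDerived G)
    (hp : IsPGroup p G) (h12 : ¬ lcs G 1 ≤ lcs G 2) : Nonempty (LowerLayers p G) := by
  have hpow := hG.pow_mem_lcs_of_mem hp h12
  obtain ⟨V, _, _, _, πV, hV⟩ := exists_isSection (H := (⊤ : Subgroup G)) (K := lcs G 1) (p := p)
    le_rfl (hpow 0)
  obtain ⟨W, _, _, _, πW, hW⟩ := exists_isSection (H := lcs G 1) (K := lcs G 2) (p := p)
    (Subgroup.commutator_mono le_rfl le_top) (hpow 1)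
  have hinv := hW.isInvariantHom
  have hc := commutator_mem_lcs_one (G := G)
  obtain ⟨b, hb⟩ := hV.exists_bilinear (p := p) hV (fun x y => πW ⁅x, y⁆)
    (fun y _ x _ x' _ => hinv.map_mul_commutator (hc x y) (hc x' y))
    (fun x _ y _ y' _ => hinv.map_commutator_mul (hc x y) (hc x y'))
    (fun y _ x _ hx => (hW.eq_zero_iff _ (hc x y)).2 (commutator_mem_lcs hx y))
    (fun x _ y _ hy => (hW.eq_zero_iff _ (hc x y)).2 (commutator_mem_lcs' hy x))
  exact ⟨{ V := V, W := W, πV := πV, πW := πW, isSectionV := hV, isSectionW := hW, b := b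
           b_apply := fun x y => hb x (mem_top x) y (mem_top y) }⟩

namespace LowerLayers

variable (L : LowerLayers p G)

theorem πV_surjective : Function.Surjective L.πV := fun v => by
  obtain ⟨a, -, ha⟩ := L.isSectionV.surj v
  exact ⟨a, ha⟩

theorem πV_eq_zero_iff {x : G} : L.πV x = 0 ↔ x ∈ lcs G 1 := L.isSectionV.eq_zero_iff x (mem_top x)

theorem πV_mul (x y : G) : L.πV (x * y) = L.πV x + L.πV y :=
  L.isSectionV.map_mul x (mem_top x) y (mem_top y)

theorem πV_inv (x : G) : L.πV x⁻¹ = -L.πV x := L.isSectionV.map_inv (mem_top x)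

theorem b_eq_zero_iff {x y : G} : L.b (L.πV x) (L.πV y) = 0 ↔ ⁅x, y⁆ ∈ lcs G 2 := by
  rw [L.b_apply, L.isSectionW.eq_zero_iff _ (commutator_mem_lcs_one x y)]

theorem b_self (v : L.V) : L.b v v = 0 := by
  obtain ⟨x, rfl⟩ := L.πV_surjective v
  rw [L.b_eq_zero_iff, commutatorElement_self]
  exact one_mem _

theorem b_surjective (hG : CommutatorsFillDerived G) (v : L.V) (hv : v ≠ 0) :
    Function.Surjective (L.b v) := by
  intro w
  obtain ⟨x, rfl⟩ := L.πV_surjective v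
  obtain ⟨z, hz, rfl⟩ := L.isSectionW.surj w
  obtain ⟨g, rfl⟩ := hG x (fun h => hv (L.πV_eq_zero_iff.2 h)) z hz
  exact ⟨L.πV g, L.b_apply x g⟩

variable {μ : G → ZMod p}

/-- `ψ : W × V → ZMod p` is the pairing `(w, x) ↦ μ [w, x]`. -/
def IsPairing (μ : G → ZMod p) (ψ : L.W →ₗ[ZMod p] L.V →ₗ[ZMod p] ZMod p) : Prop :=
  ∀ w ∈ lcs G 1, ∀ x, ψ (L.πW w) (L.πV x) = μ ⁅w, x⁆

theorem exists_isPairing (hμ : IsInvariantHom (lcs G 2) μ) : ∃ ψ, L.IsPairing μ ψ := by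
  obtain ⟨ψ, hψ⟩ := L.isSectionW.exists_bilinear (p := p) L.isSectionV (fun w x => μ ⁅w, x⁆)
    (fun x _ w hw w' hw' => (hμ.commutator x).map_mul w hw w' hw')
    (fun w hw x _ x' _ =>
      hμ.map_commutator_mul (commutator_mem_lcs hw x) (commutator_mem_lcs hw x'))
    (fun x _ w _ hw => hμ.eq_zero_of_mem (commutator_mem_lcs hw x))
    (fun w hw x _ hx => hμ.eq_zero_of_mem
      (commutator_lcs_one_lcs_le 1 (Subgroup.commutator_mem_commutator hw hx)))
  exact ⟨ψ, fun w hw x => hψ w hw x (mem_top x)⟩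

variable {L} {ψ : L.W →ₗ[ZMod p] L.V →ₗ[ZMod p] ZMod p}

theorem IsPairing.swap (hψ : L.IsPairing μ ψ) (hμ : IsInvariantHom (lcs G 2) μ) {w : G}
    (hw : w ∈ lcs G 1) (x : G) : μ ⁅x, w⁆ = -ψ (L.πW w) (L.πV x) := by
  rw [hψ w hw, hμ.map_commutator_swap (commutator_mem_lcs hw x)]

theorem IsPairing.jacobi (hψ : L.IsPairing μ ψ) (hμ : IsInvariantHom (lcs G 2) μ) (x y z : L.V) :
    ψ (L.b x y) z + ψ (L.b y z) x + ψ (L.b z x) y = 0 := by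
  obtain ⟨x, rfl⟩ := L.πV_surjective x
  obtain ⟨y, rfl⟩ := L.πV_surjective y
  obtain ⟨z, rfl⟩ := L.πV_surjective z
  have hc := commutator_mem_lcs_one (G := G)
  have h := hμ.hall_witt (x := x) (y := y) (z := z) (commutator_mem_lcs' (hc _ _) _)
    (commutator_mem_lcs' (hc _ _) _)
  rw [hψ.swap hμ (hc _ _), hψ.swap hμ (hc _ _), hψ.swap hμ (hc _ _), ← L.b_apply, ← L.b_apply,
    ← L.b_apply] at h
  simp only [L.πV_inv, map_neg, LinearMap.neg_apply, neg_neg] at h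
  linear_combination -h

theorem IsPairing.ne_zero (hψ : L.IsPairing μ ψ) (hμ : IsInvariantHom (lcs G 2) μ) {z : G}
    (hz : z ∈ lcs G 2) (hμz : μ z ≠ 0) : ψ ≠ 0 := by
  rintro rfl
  exact hμz (hμ.eq_zero_of_forall_commutator (fun w hw x => (hψ w hw x).symm) hz)

end LowerLayers

/-! ### Camina groups of class three -/

/-- If the last nontrivial term of the lower central series has exponent `p`, its elements outside
a subgroup are detected by invariant homomorphisms into `ZMod p`. -/
theorem exists_isInvariantHom [Fact p.Prime] [Finite G] {k : ℕ} (hbot : lcs G (k + 1) = ⊥)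
    (hpow : ∀ a ∈ lcs G k, a ^ p ∈ lcs G (k + 1)) (S : Subgroup G) {z : G} (hz : z ∈ lcs G k)
    (hzS : z ∉ S) :
    ∃ μ : G → ZMod p, IsInvariantHom (lcs G k) μ ∧ μ z ≠ 0 ∧ ∀ s ∈ lcs G k, s ∈ S → μ s = 0 := by
  have hle : lcs G (k + 1) ≤ S := hbot ▸ bot_le
  obtain ⟨A, _, _, _, π, hπ⟩ := exists_isSection (H := lcs G k) (K := S) (p := p)
    ((Subgroup.commutator_mono le_rfl le_top).trans hle) (fun a ha => hle (hpow a ha))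
  have hz0 : π z ≠ 0 := fun h => hzS ((hπ.eq_zero_iff z hz).1 h)
  obtain ⟨l, hl⟩ : ∃ l : Module.Dual (ZMod p) A, l (π z) ≠ 0 := by
    by_contra! h
    exact hz0 ((Module.forall_dual_apply_eq_zero_iff (ZMod p) _).1 h)
  refine ⟨fun g => l (π g), ⟨fun a ha b hb => ?_, fun g a ha => ?_⟩, hl, fun s hs hsS => ?_⟩
  · rw [hπ.map_mul a ha b hb, map_add]
  · have h : ⁅g, a⁆ = 1 := by
      rw [← Subgroup.mem_bot, ← hbot]
      exact commutator_mem_lcs' ha g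
    rw [commutatorElement_eq_one_iff_mul_comm] at h
    rw [h, mul_inv_cancel_right]
  · change l (π s) = 0
    rw [(hπ.eq_zero_iff s hs).2 hsS, map_zero]

theorem eq_of_mem_bot_lcs {k : ℕ} (hbot : lcs G (k + 1) = ⊥) {a : G} (ha : a ∈ lcs G k) (g : G) :
    g * a = a * g := by
  rw [← commutatorElement_eq_one_iff_mul_comm, ← Subgroup.mem_bot, ← hbot]
  exact commutator_mem_lcs' ha g

/-- In a Camina `p`-group of class at most three, `g ↦ [u, g]` maps onto the last term of the lower
central series for every `u ∈ G'` outside that term. -/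
theorem CommutatorsFillDerived.commutators_fill_lcs_two [Fact p.Prime] [Finite G]
    (hG : CommutatorsFillDerived G) (hp : IsPGroup p G) (h3 : lcs G 3 = ⊥) {u : G}
    (hu : u ∈ lcs G 1) (hu2 : u ∉ lcs G 2) {z : G} (hz : z ∈ lcs G 2) : ∃ g, ⁅u, g⁆ = z := by
  have h12 : ¬ lcs G 1 ≤ lcs G 2 := fun h => hu2 (h hu)
  have hcent : ∀ g h : G, h * ⁅u, g⁆ = ⁅u, g⁆ * h := fun g h =>
    eq_of_mem_bot_lcs h3 (commutator_mem_lcs hu g) h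
  have hmul : ∀ g h : G, ⁅u, g * h⁆ = ⁅u, g⁆ * ⁅u, h⁆ := fun g h => by
    have : ⁅u, g * h⁆ = ⁅u, g⁆ * (g * ⁅u, h⁆ * g⁻¹) := by
      simp only [commutatorElement_def]
      group
    rw [this, hcent, mul_inv_cancel_right]
  by_contra! hne
  obtain ⟨μ, hμ, hμz, hμS⟩ := exists_isInvariantHom h3 (hG.pow_mem_lcs_of_mem hp h12 2)
    (MonoidHom.mk' (fun g => ⁅u, g⁆) hmul).range hz (by
      rintro ⟨g, hg⟩
      exact hne g hg)
  obtain ⟨L⟩ := hG.nonempty_lowerLayers hp h12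
  obtain ⟨ψ, hψ⟩ := L.exists_isPairing hμ
  have h := (finrank_of_class_three L.b_self (L.b_surjective hG) (hψ.ne_zero hμ hz hμz)
    (hψ.jacobi hμ)).2.1 (L.πW u) fun x => by
      obtain ⟨x, rfl⟩ := L.πV_surjective x
      rw [hψ u hu]
      exact hμS _ (commutator_mem_lcs hu x) ⟨x, rfl⟩
  exact hu2 ((L.isSectionW.eq_zero_iff u hu).1 h)

/-- A Camina `2`-group of class at most three has class at most two. -/
theorem CommutatorsFillDerived.lcs_two_eq_bot_of_two [Finite G] (hG : CommutatorsFillDerived G)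
    (hp : IsPGroup 2 G) (h3 : lcs G 3 = ⊥) : lcs G 2 = ⊥ := by
  by_contra h2
  have hZ : ∀ c : ZMod 2, c = 0 ∨ c = 1 := by decide
  have : Fact (Nat.Prime 2) := ⟨Nat.prime_two⟩
  have := hp.isNilpotent
  have h12 : ¬ lcs G 1 ≤ lcs G 2 := fun h =>
    h2 (eq_bot_iff.2 ((lcs_le one_le_two).trans (lcs_eq_bot_of_eq_succ h).le))
  have hpow := hG.pow_mem_lcs_of_mem hp h12
  obtain ⟨z, hz, hz1⟩ := (Subgroup.bot_or_exists_ne_one _).resolve_left h2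
  obtain ⟨μ, hμ, hμz, -⟩ := exists_isInvariantHom h3 (hpow 2) ⊥ hz hz1
  obtain ⟨L⟩ := hG.nonempty_lowerLayers hp h12
  obtain ⟨ψ, hψ⟩ := L.exists_isPairing hμ
  have hψ0 := hψ.ne_zero hμ hz hμz
  have hbs := L.b_surjective hG
  obtain ⟨hfV, -, hfX, -⟩ := finrank_of_class_three L.b_self hbs hψ0 (hψ.jacobi hμ)
  have hker := fun x hx0 hx => ker_eq_of_class_three L.b_self hbs hψ0 (hψ.jacobi hμ) (x := x) hx0 hx
  set X := LinearMap.ker ψ.flip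
  have hX : ∀ x, x ∈ X ↔ ∀ w, ψ w x = 0 := fun x => by
    rw [LinearMap.mem_ker, LinearMap.ext_iff]
    rfl
  have hm : 2 ≤ Module.finrank (ZMod 2) X := by
    by_contra hlt
    obtain ⟨v, hv, hv0⟩ : ∃ v ∈ X, v ≠ 0 := by
      have : X ≠ ⊥ := fun h => by
        rw [h, finrank_bot] at hfX
        have : Subsingleton L.W := Module.finrank_zero_iff.1 hfX.symm
        exact hψ0 (LinearMap.ext fun w => by rw [Subsingleton.elim w 0, map_zero, map_zero])
      exact Submodule.exists_mem_ne_zero_of_ne_bot this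
    have h1 : Module.finrank (ZMod 2) X = 1 := by
      have : Module.finrank (ZMod 2) X ≠ 0 := fun h => hv0 (by
        rw [Submodule.finrank_eq_zero] at h
        rwa [h, Submodule.mem_bot] at hv)
      omega
    obtain ⟨h, rfl⟩ := L.πV_surjective v
    have hh : h ∉ lcs G 1 := fun hh => hv0 (L.πV_eq_zero_iff.2 hh)
    obtain ⟨g, rfl⟩ := hG h hh z (lcs_le one_le_two hz)
    have hgX : L.πV g ∈ X := by
      rw [← hker _ hv0 ((hX _).1 hv)]
      exact L.b_eq_zero_iff.2 hz
    -- The line `X` consists of `0` and the image of `h`, so `g` commutes with `h` under `μ`.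
    obtain ⟨c, hc⟩ := (finrank_eq_one_iff_of_nonzero' (⟨_, hv⟩ : X) (fun h => hv0
      (congrArg Subtype.val h))).1 h1 ⟨_, hgX⟩
    replace hc : c • L.πV h = L.πV g := congrArg Subtype.val hc
    have hsw : ∀ w ∈ lcs G 1, μ ⁅h, w⁆ = 0 := fun w hw => by
      rw [hψ.swap hμ hw, (hX _).1 hv, neg_zero]
    rcases hZ c with rfl | rfl
    · rw [zero_smul, eq_comm, L.πV_eq_zero_iff] at hc
      exact hμz (hsw g hc)
    · rw [one_smul] at hc
      have hw : h⁻¹ * g ∈ lcs G 1 := by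
        rw [← L.πV_eq_zero_iff, L.πV_mul, L.πV_inv, hc, neg_add_cancel]
      apply hμz
      rw [← mul_inv_cancel_left h g, hμ.map_commutator_mul (by simp) (commutator_mem_lcs' hw h),
        hsw _ hw, commutatorElement_self, hμ.map_one, add_zero]
  -- Outside `X`, the pairing with `y` is the squaring map, whatever `y` is.
  have hsq : ∀ y, L.πV y ∉ X → ∀ w ∈ lcs G 1, ψ (L.πW w) (L.πV y) = μ (w ^ 2) := by
    intro y hy w hw
    have hinj : Function.Injective ((L.b (L.πV y)).domRestrict X) := by
      rw [injective_iff_map_eq_zero]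
      intro x hx
      by_contra hx0
      refine hy ?_
      rw [← hker x.1 (fun h => hx0 (Subtype.ext h)) ((hX _).1 x.2), LinearMap.mem_ker]
      have h1 := LinearMap.add_swap_eq_zero_of_alternating L.b_self x.1 (L.πV y)
      rwa [show L.b (L.πV y) x.1 = 0 from hx, add_zero] at h1
    have hsurj := (LinearMap.injective_iff_surjective_of_finrank_eq_finrank hfX).1 hinj
    obtain ⟨⟨x, hx⟩, hxw⟩ := hsurj (-L.πW w)
    obtain ⟨h, rfl⟩ := L.πV_surjective x
    have hhw : L.πW ⁅h, y⁆ = L.πW w := by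
      have h1 := LinearMap.add_swap_eq_zero_of_alternating L.b_self (L.πV h) (L.πV y)
      rw [show L.b (L.πV y) (L.πV h) = -L.πW w from hxw, L.b_apply, ← sub_eq_add_neg,
        sub_eq_zero] at h1
      exact h1
    set v := ⁅h, y⁆ with hv
    have hvm : v ∈ lcs G 1 := commutator_mem_lcs_one h y
    have hvw : v⁻¹ * w ∈ lcs G 2 := by
      rw [← L.isSectionW.eq_zero_iff _ (mul_mem (inv_mem hvm) hw),
        L.isSectionW.map_mul _ (inv_mem hvm) _ hw, L.isSectionW.map_inv hvm, hhw, neg_add_cancel]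
    have hwv : w ^ 2 = v ^ 2 := by
      have h1 : w = v * (v⁻¹ * w) := (mul_inv_cancel_left v w).symm
      have h4 : (v⁻¹ * w) ^ 2 = 1 := by
        rw [← Subgroup.mem_bot, ← h3]
        exact hpow 2 _ hvw
      rw [h1, (show Commute v (v⁻¹ * w) from eq_of_mem_bot_lcs h3 hvw v).mul_pow, h4, mul_one]
    rw [hwv, ← hhw, hψ v hvm]
    have hyv := commutator_mem_lcs' hvm y
    have hv2 : v ^ 2 ∈ lcs G 2 := hpow 1 v hvm
    have h5 : ⁅h, y ^ 2⁆ = v * ⁅y, v⁆ * v⁻¹ * v ^ 2 := by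
      simp only [hv, commutatorElement_def, sq]
      group
    have h6 : μ ⁅h, y ^ 2⁆ = 0 := by
      rw [hψ.swap hμ (hpow 0 y (mem_top y)), (hX _).1 hx, neg_zero]
    rw [h5, hμ.map_mul _ (Normal.conj_mem inferInstance _ hyv v) _ hv2, hμ.map_conj _ _ hyv,
      hμ.map_commutator_swap (commutator_mem_lcs hvm y)] at h6
    linear_combination -h6
  obtain ⟨y₁, hy₁⟩ : ∃ y, y ∉ X := by
    by_contra! h
    have : X = ⊤ := (Submodule.eq_top_iff').2 h
    rw [this, finrank_top] at hfX hm
    omega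
  obtain ⟨y₂, hy₂⟩ : ∃ y, y ∉ X ⊔ Submodule.span (ZMod 2) {y₁} := by
    by_contra! h
    have h1 := Submodule.finrank_add_le_finrank_add_finrank X (Submodule.span (ZMod 2) {y₁})
    rw [(Submodule.eq_top_iff').2 h, finrank_top] at h1
    have h4 := finrank_span_singleton (K := ZMod 2) (v := y₁) (fun h => hy₁ (h ▸ zero_mem X))
    omega
  have hy₂' : y₂ ∉ X := fun h => hy₂ (Submodule.mem_sup_left h)
  have hy₃ : y₁ + y₂ ∉ X := fun h => hy₂ (by
    rw [← add_sub_cancel_left y₁ y₂]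
    exact sub_mem (Submodule.mem_sup_left h)
      (Submodule.mem_sup_right (Submodule.mem_span_singleton_self y₁)))
  obtain ⟨g₁, rfl⟩ := L.πV_surjective y₁
  obtain ⟨g₂, rfl⟩ := L.πV_surjective y₂
  refine hy₁ ((hX _).2 fun w => ?_)
  obtain ⟨w, hw, rfl⟩ := L.isSectionW.surj w
  have h5 := hsq (g₁ * g₂) (by rwa [L.πV_mul]) w hw
  rw [L.πV_mul, map_add, hsq g₁ hy₁ w hw, hsq g₂ hy₂' w hw] at h5
  rw [hsq g₁ hy₁ w hw]
  linear_combination h5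

end

section

open Subgroup
open scoped commutatorElement

variable {p : ℕ} {G : Type u} [Group G]

/-! ### Camina groups of class four -/

/-- For odd `p`, a Camina `p`-group of class at most four has class at most three. -/
theorem CommutatorsFillDerived.lcs_three_eq_bot_of_ne_two [Fact p.Prime] [Finite G]
    (hG : CommutatorsFillDerived G) (hp : IsPGroup p G) (hp2 : p ≠ 2) (h4 : lcs G 4 = ⊥) :
    lcs G 3 = ⊥ := by
  by_contra h3
  have := hp.isNilpotent
  have h12 : ¬ lcs G 1 ≤ lcs G 2 := fun h =>
    h3 (eq_bot_iff.2 ((lcs_le (by omega)).trans (lcs_eq_bot_of_eq_succ h).le))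
  have hpow := hG.pow_mem_lcs_of_mem hp h12
  obtain ⟨z, hz, hz1⟩ := (Subgroup.bot_or_exists_ne_one _).resolve_left h3
  obtain ⟨τ, hτ, hτz, -⟩ := exists_isInvariantHom h4 (hpow 3) ⊥ hz hz1
  obtain ⟨L⟩ := hG.nonempty_lowerLayers hp h12
  have hbs := L.b_surjective hG
  have hc1 := commutator_mem_lcs_one (G := G)
  have h11 : ∀ v ∈ lcs G 1, ∀ w ∈ lcs G 1, ⁅v, w⁆ ∈ lcs G 3 := fun v hv w hw =>
    commutator_lcs_one_lcs_le 1 (Subgroup.commutator_mem_commutator hv hw)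
  have h12' : ∀ v ∈ lcs G 1, ∀ u ∈ lcs G 2, ⁅v, u⁆ ∈ lcs G 4 := fun v hv u hu =>
    commutator_lcs_one_lcs_le 2 (Subgroup.commutator_mem_commutator hv hu)
  have h21 : ∀ u ∈ lcs G 2, ∀ v ∈ lcs G 1, ⁅u, v⁆ ∈ lcs G 4 := fun u hu v hv => by
    rw [← commutatorElement_inv]
    exact inv_mem (h12' v hv u hu)
  have hc2 : ∀ w ∈ lcs G 1, ∀ x, ⁅w, x⁆ ∈ lcs G 2 := fun w hw x => commutator_mem_lcs hw x
  have hc3 : ∀ u ∈ lcs G 2, ∀ x, ⁅u, x⁆ ∈ lcs G 3 := fun u hu x => commutator_mem_lcs hu x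
  -- The functional `u ↦ τ [u, c]` on the third term of the series.
  have hμ := fun c => hτ.commutator c
  obtain ⟨Φ, hΦ⟩ := L.isSectionW.exists_trilinear (p := p) L.isSectionV L.isSectionV
    (fun w x c => τ ⁅⁅w, x⁆, c⁆)
    (fun x _ c _ w hw w' hw' => ((hμ c).commutator x).map_mul w hw w' hw')
    (fun w hw c _ x _ x' _ => (hμ c).map_commutator_mul (hc2 w hw x) (hc2 w hw x'))
    (fun w hw x _ c _ c' _ => hτ.map_commutator_mul (hc3 _ (hc2 w hw x) c) (hc3 _ (hc2 w hw x) c'))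
    (fun x _ c _ w _ hw => (hμ c).eq_zero_of_mem (hc3 w hw x))
    (fun w hw c _ x _ hx => (hμ c).eq_zero_of_mem (h11 w hw x hx))
    (fun w hw x _ c _ hc => hτ.eq_zero_of_mem (h21 _ (hc2 w hw x) c hc))
  replace hΦ : ∀ w ∈ lcs G 1, ∀ x c, Φ (L.πW w) (L.πV x) (L.πV c) = τ ⁅⁅w, x⁆, c⁆ :=
    fun w hw x c => hΦ w hw x (mem_top x) c (mem_top c)
  obtain ⟨β, hβ⟩ := L.isSectionW.exists_bilinear (p := p) L.isSectionW (fun v w => τ ⁅v, w⁆)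
    (fun w hw v hv v' hv' => hτ.map_mul_commutator (h11 v hv w hw) (h11 v' hv' w hw))
    (fun v hv w hw w' hw' => hτ.map_commutator_mul (h11 v hv w hw) (h11 v hv w' hw'))
    (fun w hw v _ hv => hτ.eq_zero_of_mem (h21 v hv w hw))
    (fun v hv w _ hw => hτ.eq_zero_of_mem (h12' v hv w hw))
  have hpair : ∀ c, L.IsPairing (fun u => τ ⁅u, c⁆) (evalLast Φ (L.πV c)) := fun c w hw x =>
    hΦ w hw x c
  have hJ : ∀ c x y z, evalLast Φ c (L.b x y) z + evalLast Φ c (L.b y z) x +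
      evalLast Φ c (L.b z x) y = 0 := fun c => by
    obtain ⟨c, rfl⟩ := L.πV_surjective c
    exact (hpair c).jacobi (hμ c)
  have hΦ0 : Φ ≠ 0 := by
    rintro rfl
    refine hτz (hτ.eq_zero_of_forall_commutator (fun u hu c => ?_) hz)
    exact (hμ c).eq_zero_of_forall_commutator (fun w hw x => (hΦ w hw x c).symm) hu
  have h2 : (2 : ZMod p) ≠ 0 := fun h => by
    have h' : ((2 : ℕ) : ZMod p) = 0 := by exact_mod_cast h
    rw [ZMod.natCast_eq_zero_iff] at h'
    exact hp2 ((Nat.prime_dvd_prime_iff_eq Fact.out Nat.prime_two).1 h')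
  refine false_of_class_four h2 L.b_self hbs hΦ0 (β := β) (fun w => ?_) (fun w x y => ?_)
    (fun x y z t => hJ t x y z) (fun x hx0 => ?_)
  · obtain ⟨w, hw, rfl⟩ := L.isSectionW.surj w
    rw [hβ w hw w hw, commutatorElement_self, hτ.map_one]
  · obtain ⟨w, hw, rfl⟩ := L.isSectionW.surj w
    obtain ⟨x, rfl⟩ := L.πV_surjective x
    obtain ⟨y, rfl⟩ := L.πV_surjective y
    have hw' := inv_mem hw
    have hxw := hc2 _ hw' y⁻¹
    have hwx : ⁅y⁻¹, w⁻¹⁆ ∈ lcs G 2 := commutator_mem_lcs' hw' y⁻¹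
    have h := hτ.hall_witt (x := w) (y := x) (z := y) (h11 _ hw' _ (hc1 _ _))
      (commutator_mem_lcs' hwx _)
    have e1 : τ ⁅y, ⁅w, x⁆⁆ = -Φ (L.πW w) (L.πV x) (L.πV y) := by
      rw [hΦ w hw, hτ.map_commutator_swap (hc3 _ (hc2 w hw x) y)]
    have e2 : τ ⁅x, ⁅y⁻¹, w⁻¹⁆⁆ = Φ (L.πW w) (L.πV y) (L.πV x) := by
      have e : τ ⁅⁅y⁻¹, w⁻¹⁆, x⁆ = -τ ⁅⁅w⁻¹, y⁻¹⁆, x⁆ := (hμ x).map_commutator_swap hxw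
      rw [hτ.map_commutator_swap (hc3 _ hwx x), e, neg_neg, ← hΦ _ hw', L.πV_inv,
        L.isSectionW.map_inv hw]
      simp only [map_neg, LinearMap.neg_apply, neg_neg]
    have e3 : τ ⁅w⁻¹, ⁅x⁻¹, y⁆⁆ = β (L.πW w) (L.b (L.πV x) (L.πV y)) := by
      rw [← hβ _ hw' _ (hc1 _ _), ← L.b_apply, L.πV_inv, L.isSectionW.map_inv hw]
      simp only [map_neg, LinearMap.neg_apply, neg_neg]
    rw [e1, e2, e3] at h
    linear_combination -h
  · by_cases hle : lastAnnihilator Φ x ≤ lastRadical Φ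
    · have := Submodule.finrank_mono hle
      omega
    obtain ⟨c₁, hc₁x, hc₁⟩ := SetLike.not_le_iff_exists.1 hle
    have hker : ∀ c ∈ lastAnnihilator Φ x, c ∉ lastRadical Φ →
        LinearMap.ker (L.b x) = LinearMap.ker (evalLast Φ c).flip := fun c hc hc' =>
      ker_eq_of_class_three L.b_self hbs (evalLast_ne_zero hc') (hJ c) hx0 hc
    obtain ⟨-, -, hfC, hiso⟩ :=
      finrank_of_class_three L.b_self hbs (evalLast_ne_zero hc₁) (hJ c₁)
    rw [← hker c₁ hc₁x hc₁] at hfC hiso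
    set C := LinearMap.ker (L.b x)
    have hC : ∀ v ∈ C, v ≠ 0 → LinearMap.ker (L.b v) = C := by
      intro v hv hv0
      have hv' : v ∈ LinearMap.ker (evalLast Φ c₁).flip := hker c₁ hc₁x hc₁ ▸ hv
      rw [hker c₁ hc₁x hc₁]
      exact ker_eq_of_class_three L.b_self hbs (evalLast_ne_zero hc₁) (hJ c₁) hv0
        (mem_ker_flip_evalLast.1 hv')
    have hΦC : ∀ c ∈ lastAnnihilator Φ x, ∀ v ∈ C, ∀ w, Φ w v c = 0 := by
      intro c hc v hv w
      by_cases hc' : c ∈ lastRadical Φ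
      · exact hc' w v
      · rw [hker c hc hc', mem_ker_flip_evalLast] at hv
        exact hv w
    -- A complement of the radical in the annihilator of `x`.
    obtain ⟨S₀, hS₀⟩ := Submodule.exists_isCompl (lastRadical Φ)
    set S := S₀ ⊓ lastAnnihilator Φ x
    have hSsup : lastRadical Φ ⊔ S = lastAnnihilator Φ x := by
      rw [← sup_inf_assoc_of_le S₀ (lastRadical_le_lastAnnihilator Φ x), hS₀.sup_eq_top, top_inf_eq]
    have hSinf : lastRadical Φ ⊓ S = ⊥ := by
      rw [← inf_assoc, hS₀.inf_eq_bot, bot_inf_eq]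
    have hfS := Submodule.finrank_sup_add_finrank_inf_eq (lastRadical Φ) S
    rw [hSsup, hSinf, finrank_bot, add_zero] at hfS
    obtain ⟨HC, ρC, hρC, hHC, hρCπ⟩ := L.isSectionV.exists_restrict C
    obtain ⟨HS, ρS, hρS, hHS, hρSπ⟩ := L.isSectionV.exists_restrict S
    have hCC : ∀ h ∈ HC, ∀ k ∈ HC, ⁅h, k⁆ ∈ lcs G 2 := fun h hh k hk =>
      L.b_eq_zero_iff.1 (hiso _ ((hHC h).1 hh) _ ((hHC k).1 hk))
    have hkill : ∀ c ∈ HS, ∀ w ∈ lcs G 1, ∀ k ∈ HC, τ ⁅⁅w, k⁆, c⁆ = 0 := fun c hc w hw k hk => by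
      rw [← hΦ w hw]
      exact hΦC _ ((hHS c).1 hc).2 _ ((hHC k).1 hk) _
    obtain ⟨ω, hω⟩ := hρS.exists_trilinear (p := p) hρC hρC (fun c h k => τ ⁅⁅h, k⁆, c⁆)
      (fun h hh k hk c _ c' _ => hτ.map_commutator_mul (hc3 _ (hCC h hh k hk) c)
        (hc3 _ (hCC h hh k hk) c'))
      (fun c _ k hk h hh h' hh' => (hμ c).map_mul_commutator (hCC h hh k hk) (hCC h' hh' k hk))
      (fun c _ h hh k hk k' hk' => (hμ c).map_commutator_mul (hCC h hh k hk) (hCC h hh k' hk'))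
      (fun h hh k hk c _ hc => hτ.eq_zero_of_mem (h21 _ (hCC h hh k hk) c hc))
      (fun c hc k hk h _ hh => hkill c hc h hh k hk)
      (fun c hc h hh k hk hk' => by
        have e : τ ⁅⁅h, k⁆, c⁆ = -τ ⁅⁅k, h⁆, c⁆ := (hμ c).map_commutator_swap (hCC k hk h hh)
        rw [e, hkill c hc k hk' h hh, neg_zero])
    have hCpos : 0 < Module.finrank (ZMod p) C :=
      Module.finrank_pos_iff_exists_ne_zero.2
        ⟨⟨x, LinearMap.mem_ker.2 (L.b_self x)⟩, fun h => hx0 (congrArg Subtype.val h)⟩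
    have hωle := two_mul_finrank_le_of_nondegenerate ω (fun s v => ?_) (fun s hs v hv => ?_) hCpos
    · omega
    · obtain ⟨c, hc, rfl⟩ := hρS.surj s
      obtain ⟨h, hh, rfl⟩ := hρC.surj v
      rw [hω c hc h hh h hh, commutatorElement_self, commutatorElement_one_left, hτ.map_one]
    · obtain ⟨c, hc, rfl⟩ := hρS.surj s
      obtain ⟨h, hh, rfl⟩ := hρC.surj v
      have hcS : L.πV c ∈ S := (hHS c).1 hc
      have hc0 : L.πV c ∉ lastRadical Φ := fun h0 => hs (Subtype.ext (by
        have : L.πV c ∈ lastRadical Φ ⊓ S := ⟨h0, hcS⟩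
        rw [hSinf, Submodule.mem_bot] at this
        rw [hρSπ c hc, this]
        rfl))
      by_contra hv0
      have hh0 : L.πV h ≠ 0 := fun h0 => hv0 (Subtype.ext ((hρCπ h hh).trans h0))
      obtain ⟨w, y, hwy⟩ : ∃ w y, Φ w y (L.πV c) ≠ 0 := by
        by_contra! h0
        exact hc0 h0
      obtain ⟨w, hw, rfl⟩ := L.isSectionW.surj w
      obtain ⟨y, rfl⟩ := L.πV_surjective y
      -- The commutators of `h` fill `G'`, and those lying in `lcs G 2` come from `C`.
      obtain ⟨g, hg⟩ := hG h (fun h1 => hh0 (L.πV_eq_zero_iff.2 h1)) ⁅w, y⁆ (hc1 w y)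
      have hgC : g ∈ HC := by
        rw [hHC, ← hC _ ((hHC h).1 hh) hh0, LinearMap.mem_ker, L.b_eq_zero_iff, hg]
        exact hc2 w hw y
      have h1 := hv (ρC g)
      rw [hω c hc h hh g hgC, hg, ← hΦ w hw] at h1
      exact hwy h1

theorem lcs_quotient_eq_bot (n : ℕ) : lcs (G ⧸ lcs G n) n = ⊥ := by
  rw [← map_lcs (QuotientGroup.mk'_surjective _), Subgroup.map_eq_bot_iff, QuotientGroup.ker_mk']

/-- A Camina `p`-group has nilpotency class at most three. -/
theorem CommutatorsFillDerived.lcs_three_eq_bot [Fact p.Prime] [Finite G]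
    (hG : CommutatorsFillDerived G) (hp : IsPGroup p G) : lcs G 3 = ⊥ := by
  have := hp.isNilpotent
  have hQ := fun n => hG.of_surjective (QuotientGroup.mk'_surjective (lcs G n))
  by_cases h2 : p = 2
  · subst h2
    have h : lcs G 2 = ⊥ := lcs_eq_bot_of_quotient
      ((hQ 3).lcs_two_eq_bot_of_two (hp.to_quotient _) (lcs_quotient_eq_bot 3))
    exact eq_bot_iff.2 ((lcs_le (by omega)).trans h.le)
  · exact lcs_eq_bot_of_quotient
      ((hQ 4).lcs_three_eq_bot_of_ne_two (hp.to_quotient _) h2 (lcs_quotient_eq_bot 4))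

/-! ### Conjugacy classes of a Camina group -/

/-- In a Camina `p`-group the class of an element of `lcs G k` outside `lcs G (k + 1)` is a coset
of `lcs G (k + 1)`. -/
theorem CommutatorsFillDerived.isConj_mul [Fact p.Prime] [Finite G]
    (hG : CommutatorsFillDerived G) (hp : IsPGroup p G) {k : ℕ} {x : G} (hx : x ∈ lcs G k)
    (hx' : x ∉ lcs G (k + 1)) {z : G} (hz : z ∈ lcs G (k + 1)) : IsConj x (x * z) := by
  have h3 := hG.lcs_three_eq_bot hp
  suffices h : ∃ g, ⁅x⁻¹, g⁆ = z by
    obtain ⟨g, rfl⟩ := h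
    rw [isConj_iff]
    refine ⟨g, ?_⟩
    simp only [commutatorElement_def]
    group
  have hxi : x⁻¹ ∉ lcs G (k + 1) := fun h => hx' (by simpa using inv_mem h)
  match k with
  | 0 => exact hG _ hxi z hz
  | 1 => exact hG.commutators_fill_lcs_two hp h3 (inv_mem hx) hxi hz
  | k + 2 =>
    have h := lcs_le (G := G) (show 3 ≤ k + 2 + 1 by omega) hz
    rw [h3, Subgroup.mem_bot] at h
    exact ⟨1, by rw [commutatorElement_one_right, h]⟩

theorem exists_mem_lcs_not_mem_succ [Group.IsNilpotent G] {x : G} (hx : x ≠ 1) :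
    ∃ k, x ∈ lcs G k ∧ x ∉ lcs G (k + 1) := by
  by_contra! h
  obtain ⟨n, hn⟩ := Subgroup.nilpotent_iff_lowerCentralSeries.1 ‹Group.IsNilpotent G›
  have hall : ∀ k, x ∈ lcs G k := fun k => by
    induction k with
    | zero => exact mem_top x
    | succ k ih => exact h k ih
  have := hall n
  rw [lcs, hn, Subgroup.mem_bot] at this
  exact hx this

theorem mk_eq_mk_of_isConj {k n : ℕ} (hkn : n ≤ k + 1) {x x' : G} (hx : x ∈ lcs G k)
    (h : IsConj x x') : QuotientGroup.mk' (lcs G n) x = QuotientGroup.mk' (lcs G n) x' := by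
  obtain ⟨c, rfl⟩ := isConj_iff.1 h
  have h1 : c * x * c⁻¹ = ⁅c, x⁆ * x := by rw [commutatorElement_def, inv_mul_cancel_right]
  have h2 : QuotientGroup.mk' (lcs G n) ⁅c, x⁆ = 1 := by
    rw [← MonoidHom.mem_ker, QuotientGroup.ker_mk']
    exact lcs_le hkn (commutator_mem_lcs' hx c)
  rw [h1, map_mul, h2, one_mul]

/-- In a Camina `p`-group the product of the class of `y` and the inverse of a different class is a
single class. -/
theorem CommutatorsFillDerived.isConj_mul_inv [Fact p.Prime] [Finite G]
    (hG : CommutatorsFillDerived G) (hp : IsPGroup p G) {x x' y y' : G} (hx : IsConj x x')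
    (hy : IsConj y y') (hxy : ¬ IsConj x y) : IsConj (y * x⁻¹) (y' * x'⁻¹) := by
  have := hp.isNilpotent
  by_cases hx1 : x = 1
  · subst hx1
    rw [isConj_one_right.1 hx]
    simpa using hy
  by_cases hy1 : y = 1
  · subst hy1
    rw [isConj_one_right.1 hy, one_mul, one_mul]
    obtain ⟨c, rfl⟩ := isConj_iff.1 hx
    exact isConj_iff.2 ⟨c, by group⟩
  obtain ⟨i, hi, hi'⟩ := exists_mem_lcs_not_mem_succ hx1
  obtain ⟨j, hj, hj'⟩ := exists_mem_lcs_not_mem_succ hy1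
  -- `k` is the smaller of the two levels. For equal levels, `y * x⁻¹ ∈ lcs G (k + 1)` would put `y` in
  -- the coset of `lcs G (k + 1)` which is the class of `x`.
  obtain ⟨k, hki, hkj, hk⟩ : ∃ k, k ≤ i ∧ k ≤ j ∧ y * x⁻¹ ∉ lcs G (k + 1) := by
    rcases lt_trichotomy i j with h | h | h
    · refine ⟨i, le_rfl, h.le, fun hm => hi' ?_⟩
      rw [Subgroup.mul_mem_cancel_left _ (lcs_le h hj)] at hm
      exact inv_mem_iff.1 hm
    · subst h
      refine ⟨i, le_rfl, le_rfl, fun hm => hxy ?_⟩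
      have h1 := hG.isConj_mul hp hi hi' (Normal.conj_mem inferInstance _ hm x⁻¹)
      rwa [show x * (x⁻¹ * (y * x⁻¹) * x⁻¹⁻¹) = y by group] at h1
    · refine ⟨j, h.le, le_rfl, fun hm => hj' ?_⟩
      rwa [Subgroup.mul_mem_cancel_right _ (inv_mem (lcs_le h hi))] at hm
  have hmem : y * x⁻¹ ∈ lcs G k := mul_mem (lcs_le hkj hj) (inv_mem (lcs_le hki hi))
  have hz : (y * x⁻¹)⁻¹ * (y' * x'⁻¹) ∈ lcs G (k + 1) := by
    rw [← QuotientGroup.ker_mk' (lcs G (k + 1)), MonoidHom.mem_ker]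
    simp only [map_mul, map_inv]
    rw [mk_eq_mk_of_isConj (by omega) hi hx, mk_eq_mk_of_isConj (by omega) hj hy]
    group
  have h := hG.isConj_mul hp hmem hk hz
  rwa [mul_inv_cancel_left] at h

end

theorem mainTheorem2 (p : ℕ) (hp : p.Prime) (G : Type u) [Group G] [Fintype G]
    [DecidableEq G] (hpG : IsPGroup p G) (hG : IsCaminaGroup G) :
    AssociationScheme.IsAlmostCommutative.{u, u, w} (groupAssociationScheme G) (1 : G) := by
  have : Fact p.Prime := ⟨hp⟩
  exact isAlmostCommutative_of_isConj_mul_inv G fun x x' y y' hx hy hxy =>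
    hG.commutatorsFillDerived.isConj_mul_inv hpG hx hy hxy
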